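/- Let $\mathsf{k}$ be a field and $n\ge 0$ an integer. An $\mathbb{S}$-module is a sequence $M=\{M(j)\}_{j\ge 1}$ of ($\mathbb{Z}$-graded) differential graded $\mathsf{k}$-modules with right actions of the symmetric groups $\Sigma_j$; an operad is an $\mathbb{S}$-module $P=\{P(j)\}_{j\ge 1}$ with a unit and composition morphisms $P(r)\otimes P(i_1)\otimes\cdots\otimes P(i_r)\to P(i_1+\cdots+i_r)$ satisfying the usual unit, associativity and equivariance axioms (with Koszul signs). Let $U$ be the forgetful functor from operads to $\mathbb{S}$-modules, $F$ its left adjoint (the free operad functor) and $\epsilon$ the counit of the adjunction. Let $\mathcal{E}$ be an operad, $M$ an $\mathbb{S}$-module and $i:U(\mathcal{E})\to M$ a morphism of $\mathbb{S}$-modules (for example the inclusion of an $\mathbb{S}$-submodule), and let the polynomial operad $\mathcal{E}[M]$ be defined by the pushout of operads $$\begin{array}{ccc} FU(\mathcal{E}) & \xrightarrow{\ \epsilon\ } & \mathcal{E}\\ {\scriptstyle F(i)}\downarrow & & \downarrow{\scriptstyle\alpha}\\ F(M) & \xrightarrow{\ \beta\ } & \mathcal{E}[M].\end{array}$$ Let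 $\theta_n$ be the functor that replaces the components of arity $>n$ of an $\mathbb{S}$-module by $0$, and let $T_n$ be the functor that sends an operad to its quotient by the operadic ideal of all elements of arity $>n$, regarded as an object of the category of operads that vanish in arities $>n$. A morphism of $\mathbb{S}$-modules (respectively of operads) is called an $n$-isomorphism if $\theta_n$ (respectively $T_n$) maps it to an isomorphism. If $i$ is an $n$-isomorphism of $\mathbb{S}$-modules, then $\alpha:\mathcal{E}\to\mathcal{E}[M]$ is an $n$-isomorphism of operads. The same holds in the category of DGA-modules, that is, if all differential graded modules carry an augmentation $\varepsilon$ to $\mathsf{k}$ and a coaugmentation $\eta$ from $\mathsf{k}$ with $\varepsilon\eta=\mathrm{id}$, if all structure morphisms and all morphisms preserve both, and if $F$ and the pushout are formed in the resulting categories; here a morphism is called an $n$-isomorphism if the underlying morphism of differential graded $\mathbb{S}$-modules (respectively operads) is one. -/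

import Mathlib

open CategoryTheory CategoryTheory.Limits

universe u

/-! ### `𝕊`-modules in differential graded modules -/

/-- An `𝕊`-module: a sequence `X n`, `n ≥ 1`, of (`ℤ`-graded, homologically graded) differential
graded `k`-modules, each with a right action of the symmetric group `Σ_n` by degree `0`
chain maps. (Composition `≫` is written in diagrammatic order.) -/
structure SMod (k : Type u) [Field k] where
  X : ℕ+ → ChainComplex (ModuleCat.{u} k) ℤ
  act : ∀ n : ℕ+, Equiv.Perm (Fin n) → (X n ⟶ X n)
  act_one : ∀ n, act n 1 = 𝟙 (X n)
  act_mul : ∀ n σ τ, act n (σ * τ) = act n σ ≫ act n τ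

namespace SMod

variable {k : Type u} [Field k]

/-- The elements of arity `n` and degree `a`. -/
abbrev El (M : SMod k) (n : ℕ+) (a : ℤ) : Type u := (M.X n).X a

/-- The differential (it is zero unless `b = a - 1`). -/
abbrev bd (M : SMod k) (n : ℕ+) (a b : ℤ) : M.El n a →ₗ[k] M.El n b := ((M.X n).d a b).hom

/-- The right action of a permutation on elements. -/
abbrev ract (M : SMod k) {n : ℕ+} (σ : Equiv.Perm (Fin n)) (a : ℤ) : M.El n a →ₗ[k] M.El n a :=
  ((M.act n σ).f a).hom

/-- Apply the differential if `c` holds, and do nothing otherwise. -/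
def bdIf (M : SMod k) {n : ℕ+} (c : Prop) [h : Decidable c] {a : ℤ} (x : M.El n a) :
    M.El n (if c then a - 1 else a) :=
  match h with
  | isTrue _ => M.bd n a (a - 1) x
  | isFalse _ => x

/-- Morphisms of `𝕊`-modules: equivariant degree `0` chain maps in each arity. -/
@[ext]
structure Hom (M N : SMod k) where
  app : ∀ n, M.X n ⟶ N.X n
  comm : ∀ n σ, M.act n σ ≫ app n = app n ≫ N.act n σ

instance : Category (SMod k) where
  Hom := Hom
  id M := ⟨fun n => 𝟙 _, by simp⟩
  comp f g := ⟨fun n => f.app n ≫ g.app n, fun n σ => by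
    rw [← Category.assoc, f.comm, Category.assoc, g.comm, Category.assoc]⟩

@[ext]
theorem hom_ext {M N : SMod k} {f g : M ⟶ N} (h : ∀ n, f.app n = g.app n) : f = g :=
  Hom.ext (funext h)

@[simp] theorem id_app (M : SMod k) (n : ℕ+) : Hom.app (𝟙 M) n = 𝟙 _ := rfl
@[simp] theorem comp_app {M N P : SMod k} (f : M ⟶ N) (g : N ⟶ P) (n : ℕ+) :
    (f ≫ g).app n = f.app n ≫ g.app n := rfl

/-- A morphism of `𝕊`-modules on elements. -/
abbrev Hom.el {M N : SMod k} (f : M ⟶ N) {n : ℕ+} {a : ℤ} : M.El n a →ₗ[k] N.El n a :=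
  ((Hom.app f n).f a).hom

theorem Hom.el_bd {M N : SMod k} (f : M ⟶ N) {n : ℕ+} {a b : ℤ} (x : M.El n a) :
    Hom.el f (M.bd n a b x) = N.bd n a b (Hom.el f x) :=
  (congrArg (fun h => h.hom x) ((Hom.app f n).comm a b)).symm

theorem Hom.el_ract {M N : SMod k} (f : M ⟶ N) {n : ℕ+} {a : ℤ} (σ : Equiv.Perm (Fin n))
    (x : M.El n a) : Hom.el f (M.ract σ a x) = N.ract σ a (Hom.el f x) :=
  congrArg (fun h => (h.f a).hom x) (Hom.comm f n σ)

theorem hom_ext_el {M N : SMod k} {f g : M ⟶ N}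
    (h : ∀ n a (x : M.El n a), Hom.el f x = Hom.el g x) : f = g := by
  ext n a x
  exact h n a x

/-- Build a morphism from its values on elements. -/
def mkHom {M N : SMod k} (f : ∀ n a, M.El n a →ₗ[k] N.El n a)
    (h₁ : ∀ n a b x, f n b (M.bd n a b x) = N.bd n a b (f n a x))
    (h₂ : ∀ n a σ x, f n a (M.ract σ a x) = N.ract σ a (f n a x)) : M ⟶ N where
  app n :=
    { f := fun a => ModuleCat.ofHom (f n a)
      comm' := fun a b _ => by
        ext x
        exact (h₁ n a b x).symm }
  comm n σ := by
    ext a x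
    exact h₂ n a σ x

@[simp] theorem mkHom_el {M N : SMod k} (f : ∀ n a, M.El n a →ₗ[k] N.El n a) (h₁ h₂)
    {n : ℕ+} {a : ℤ} (x : M.El n a) : Hom.el (mkHom f h₁ h₂) x = f n a x := rfl

/-- Build an `𝕊`-module from its elements. -/
def mk' (X : ℕ+ → ℤ → Type u) [∀ n a, AddCommGroup (X n a)] [∀ n a, Module k (X n a)]
    (d : ∀ n a b, X n a →ₗ[k] X n b) (hd : ∀ n a b x, b + 1 ≠ a → d n a b x = 0)
    (dd : ∀ n a b c x, d n b c (d n a b x) = 0)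
    (act : ∀ n : ℕ+, Equiv.Perm (Fin n) → ∀ a, X n a →ₗ[k] X n a)
    (act_d : ∀ n σ a b x, act n σ b (d n a b x) = d n a b (act n σ a x))
    (act_one : ∀ n a x, act n 1 a x = x)
    (act_mul : ∀ n σ τ a x, act n (σ * τ) a x = act n τ a (act n σ a x)) : SMod k where
  X n :=
    { X := fun a => ModuleCat.of k (X n a)
      d := fun a b => ModuleCat.ofHom (d n a b)
      shape := fun a b h => by
        ext x
        exact hd n a b x h
      d_comp_d' := fun a b c _ _ => by
        ext x
        exact dd n a b c x }
  act n σ :=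
    { f := fun a => ModuleCat.ofHom (act n σ a)
      comm' := fun a b _ => by
        ext x
        exact (act_d n σ a b x).symm }
  act_one n := by
    ext a x
    exact act_one n a x
  act_mul n σ τ := by
    ext a x
    exact act_mul n σ τ a x

theorem bd_bd (M : SMod k) (n : ℕ+) (a b c : ℤ) (x : M.El n a) :
    M.bd n b c (M.bd n a b x) = 0 :=
  congrArg (fun h => h.hom x) ((M.X n).d_comp_d a b c)

theorem bd_eq_zero (M : SMod k) (n : ℕ+) (a b : ℤ) (x : M.El n a) (h : b + 1 ≠ a) :
    M.bd n a b x = 0 :=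
  congrArg (fun h => h.hom x) ((M.X n).shape a b h)

theorem ract_bd (M : SMod k) (n : ℕ+) (σ : Equiv.Perm (Fin n)) (a b : ℤ) (x : M.El n a) :
    M.ract σ b (M.bd n a b x) = M.bd n a b (M.ract σ a x) :=
  (congrArg (fun h => h.hom x) ((M.act n σ).comm a b)).symm

theorem ract_one (M : SMod k) (n : ℕ+) (a : ℤ) (x : M.El n a) : M.ract 1 a x = x :=
  congrArg (fun h => (h.f a).hom x) (M.act_one n)

theorem ract_mul (M : SMod k) (n : ℕ+) (σ τ : Equiv.Perm (Fin n)) (a : ℤ) (x : M.El n a) :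
    M.ract (σ * τ) a x = M.ract τ a (M.ract σ a x) :=
  congrArg (fun h => (h.f a).hom x) (M.act_mul n σ τ)

theorem map_bdIf {M N : SMod k} (f : ∀ n a, M.El n a → N.El n a)
    (h₁ : ∀ n a b x, f n b (M.bd n a b x) = N.bd n a b (f n a x))
    {n : ℕ+} (c : Prop) [h : Decidable c] {a : ℤ} (x : M.El n a) :
    f n _ (M.bdIf c x) = N.bdIf c (f n a x) := by
  cases h with
  | isTrue h => exact h₁ n a (a - 1) x
  | isFalse h => rfl

end SMod

/-! ### Operads -/

namespace DGOperad

/-- The positions of `n = i 0 + ⋯ + i (r-1)` inputs, read as pairs (block, place in the block),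
in lexicographic order. -/
def blocks {r : ℕ} {i : Fin r → ℕ+} {n : ℕ+} (hn : ∑ j, (i j : ℕ) = n) :
    Fin n ≃ Σ j : Fin r, Fin (i j) :=
  (finCongr hn.symm).trans finSigmaFinEquiv.symm

theorem sum_unary {A : Type*} [AddCommMonoid A] (x : A) : ∑ _j : Fin (1 : ℕ+), x = x :=
  Fintype.sum_unique (fun _ : Fin 1 => x)

theorem sum_perm {r : ℕ} {i : Fin r → ℕ+} {n : ℕ+} (σ : Equiv.Perm (Fin r))
    (hn : ∑ j, (i j : ℕ) = n) : ∑ j, (i (σ⁻¹ j) : ℕ) = n := by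
  rw [← hn]
  exact Equiv.sum_comp σ⁻¹ fun j => (i j : ℕ)

theorem deg_perm {r : ℕ} {a m : ℤ} {e : Fin r → ℤ} (σ : Equiv.Perm (Fin r))
    (hm : a + ∑ j, e j = m) : a + ∑ j, e (σ⁻¹ j) = m := by
  rw [← hm]
  exact congrArg (a + ·) (Equiv.sum_comp σ⁻¹ e)

theorem deg_left {r : ℕ} {a m : ℤ} {e : Fin r → ℤ} (hm : a + ∑ j, e j = m) :
    (a - 1) + ∑ j, e j = m - 1 := by omega

theorem deg_right {r : ℕ} {a m : ℤ} {e : Fin r → ℤ} (j : Fin r) (hm : a + ∑ j, e j = m) :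
    a + ∑ l, (if l = j then e l - 1 else e l) = m - 1 := by
  have : ∀ l, (if l = j then e l - 1 else e l) = e l - (if l = j then 1 else 0) := by
    intro l; split_ifs <;> simp
  simp only [this, Finset.sum_sub_distrib, Finset.sum_ite_eq', Finset.mem_univ, if_true]
  omega

/-- The permutation of `n = i 0 + ⋯ + i (r-1)` letters that permutes the `r` consecutive blocks
of lengths `i 0, …, i (r-1)` as `σ` permutes `r` letters: the block `j` becomes the block `σ j`,
and the order inside the blocks is kept. -/
def blockPerm {r : ℕ} {i : Fin r → ℕ+} {n : ℕ+} (σ : Equiv.Perm (Fin r))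
    (hn : ∑ j, (i j : ℕ) = n) : Equiv.Perm (Fin n) :=
  (blocks hn).trans <|
    (Equiv.sigmaCongrLeft (β := fun j => Fin (i j)) σ⁻¹).symm.trans
      (blocks (i := fun j => i (σ⁻¹ j)) (sum_perm σ hn)).symm

/-- The direct sum `τ 0 ⊕ ⋯ ⊕ τ (r-1)` of permutations: `τ j` acts inside the block `j`. -/
def sumPerm {r : ℕ} {i : Fin r → ℕ+} {n : ℕ+} (τ : ∀ j, Equiv.Perm (Fin (i j)))
    (hn : ∑ j, (i j : ℕ) = n) : Equiv.Perm (Fin n) :=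
  (blocks hn).trans <| (Equiv.sigmaCongrRight τ).trans (blocks hn).symm

end DGOperad

open DGOperad in
/-- A (symmetric, unital) operad in differential graded `k`-modules, with components in
arities `n ≥ 1`. The composition morphism
`γ : P(r) ⊗ P(i₁) ⊗ ⋯ ⊗ P(i_r) ⟶ P(i₁ + ⋯ + i_r)` is given by the corresponding
multilinear maps on homogeneous elements; the arity `n` and the degree `m` of the result are
variables that come with a proof that they have the right value. All signs follow the
Koszul convention. -/
structure DGOperad (k : Type u) [Field k] extends SMod k where
  /-- the unit -/
  one : toSMod.El 1 0
  bd_one : ∀ b, toSMod.bd 1 0 b one = 0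
  /-- composition -/
  γ : ∀ {r : ℕ+} {i : Fin r → ℕ+} {n : ℕ+} (_ : ∑ j, (i j : ℕ) = n)
    {a : ℤ} {e : Fin r → ℤ} {m : ℤ} (_ : a + ∑ j, e j = m),
    toSMod.El r a →ₗ[k] MultilinearMap k (fun j => toSMod.El (i j) (e j)) (toSMod.El n m)
  /-- composition is a chain map -/
  bd_γ : ∀ {r : ℕ+} {i : Fin r → ℕ+} {n : ℕ+} (hn : ∑ j, (i j : ℕ) = n)
    {a : ℤ} {e : Fin r → ℤ} {m : ℤ} (hm : a + ∑ j, e j = m)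
    (p : toSMod.El r a) (q : ∀ j, toSMod.El (i j) (e j)),
    toSMod.bd n m (m - 1) (γ hn hm p q) =
      γ hn (deg_left hm) (toSMod.bd r a (a - 1) p) q +
        ∑ j, (a + ∑ l ∈ Finset.Iio j, e l).negOnePow •
          γ hn (deg_right j hm) p (fun l => toSMod.bdIf (l = j) (q l))
  /-- right unit law `γ(p; 1, …, 1) = p` -/
  γ_one : ∀ {r : ℕ+} {a : ℤ} (p : toSMod.El r a),
    γ (i := fun _ => 1) (e := fun _ => 0) (n := r) (m := a) (by simp) (by simp) p
      (fun _ => one) = p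
  /-- left unit law `γ(1; q) = q` -/
  one_γ : ∀ {n : ℕ+} {m : ℤ} (q : toSMod.El n m),
    γ (r := 1) (i := fun _ => n) (e := fun _ => m) (n := n) (m := m)
      (sum_unary (n : ℕ)) ((zero_add _).trans (sum_unary m)) one (fun _ => q) = q
  /-- associativity: `γ(γ(p; q₁, …, q_r); s₁₁, s₁₂, …) = ± γ(p; γ(q₁; s₁₁, …), …, γ(q_r; s_r₁, …))`.
  The hypotheses only name the arities and degrees of the compositions that occur. -/
  assoc : ∀ {r : ℕ+} {a : ℤ} (p : toSMod.El r a)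
    {i : Fin r → ℕ+} {e : Fin r → ℤ} (q : ∀ j, toSMod.El (i j) (e j))
    {u : ∀ j, Fin (i j) → ℕ+} {f : ∀ j, Fin (i j) → ℤ} (s : ∀ j l, toSMod.El (u j l) (f j l))
    {n : ℕ+} (hn : ∑ j, (i j : ℕ) = n) {b : ℤ} (hb : a + ∑ j, e j = b)
    {v : Fin r → ℕ+} (hv : ∀ j, ∑ l, (u j l : ℕ) = v j)
    {g : Fin r → ℤ} (hg : ∀ j, e j + ∑ l, f j l = g j)
    {N : ℕ+} (hN : ∑ j, (v j : ℕ) = N)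
    (hN' : ∑ x, (u (blocks hn x).1 (blocks hn x).2 : ℕ) = N)
    {m : ℤ} (hm : a + ∑ j, g j = m) (hm' : b + ∑ x, f (blocks hn x).1 (blocks hn x).2 = m),
    γ hN' hm' (γ hn hb p q) (fun x => s (blocks hn x).1 (blocks hn x).2) =
      (∑ j, ∑ j' ∈ Finset.Ioi j, e j' * ∑ l, f j l).negOnePow •
        γ hN hm p (fun j => γ (hv j) (hg j) (q j) (s j))
  /-- equivariance `γ(p·σ; q₁, …, q_r) = ± γ(p; q_{σ⁻¹(1)}, …, q_{σ⁻¹(r)})·σ(i₁, …, i_r)` -/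
  γ_ract : ∀ {r : ℕ+} {i : Fin r → ℕ+} {n : ℕ+} (hn : ∑ j, (i j : ℕ) = n)
    {a : ℤ} {e : Fin r → ℤ} {m : ℤ} (hm : a + ∑ j, e j = m)
    (p : toSMod.El r a) (q : ∀ j, toSMod.El (i j) (e j)) (σ : Equiv.Perm (Fin r)),
    γ hn hm (toSMod.ract σ a p) q =
      (∑ j, ∑ j' ∈ Finset.Ioi j, if σ j' < σ j then e j * e j' else 0).negOnePow •
        toSMod.ract (blockPerm σ hn) m
          (γ (sum_perm σ hn) (deg_perm σ hm) p (fun j => q (σ⁻¹ j)))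
  /-- equivariance `γ(p; q₁·τ₁, …, q_r·τ_r) = γ(p; q₁, …, q_r)·(τ₁ ⊕ ⋯ ⊕ τ_r)` -/
  ract_γ : ∀ {r : ℕ+} {i : Fin r → ℕ+} {n : ℕ+} (hn : ∑ j, (i j : ℕ) = n)
    {a : ℤ} {e : Fin r → ℤ} {m : ℤ} (hm : a + ∑ j, e j = m)
    (p : toSMod.El r a) (q : ∀ j, toSMod.El (i j) (e j)) (τ : ∀ j, Equiv.Perm (Fin (i j))),
    γ hn hm p (fun j => toSMod.ract (τ j) (e j) (q j)) =
      toSMod.ract (sumPerm τ hn) m (γ hn hm p q)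

namespace DGOperad

variable {k : Type u} [Field k]

/-- Morphisms of operads: morphisms of `𝕊`-modules that respect unit and composition. -/
@[ext]
structure Hom (P Q : DGOperad k) where
  hom : P.toSMod ⟶ Q.toSMod
  map_one : SMod.Hom.el hom P.one = Q.one
  map_γ : ∀ {r : ℕ+} {i : Fin r → ℕ+} {n : ℕ+} (hn : ∑ j, (i j : ℕ) = n)
    {a : ℤ} {e : Fin r → ℤ} {m : ℤ} (hm : a + ∑ j, e j = m)
    (p : P.El r a) (q : ∀ j, P.El (i j) (e j)),
    SMod.Hom.el hom (P.γ hn hm p q) =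
      Q.γ hn hm (SMod.Hom.el hom p) (fun j => SMod.Hom.el hom (q j))

instance : Category (DGOperad k) where
  Hom := Hom
  id P := ⟨𝟙 _, rfl, fun _ _ _ _ _ _ _ => rfl⟩
  comp f g := ⟨f.hom ≫ g.hom, by
      change SMod.Hom.el g.hom (SMod.Hom.el f.hom _) = _
      rw [f.map_one, g.map_one], fun hn _ _ _ hm p q => by
      change SMod.Hom.el g.hom (SMod.Hom.el f.hom _) = _
      rw [f.map_γ, g.map_γ]
      rfl⟩

@[ext]
theorem hom_ext {P Q : DGOperad k} {f g : P ⟶ Q} (h : f.hom = g.hom) : f = g := Hom.ext h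

@[simp] theorem id_hom (P : DGOperad k) : Hom.hom (𝟙 P) = 𝟙 _ := rfl
@[simp] theorem comp_hom {P Q R : DGOperad k} (f : P ⟶ Q) (g : Q ⟶ R) :
    (f ≫ g).hom = f.hom ≫ g.hom := rfl

/-- The functor `U` that forgets unit and composition. -/
@[simps]
def forget (k : Type u) [Field k] : DGOperad k ⥤ SMod k where
  obj P := P.toSMod
  map f := f.hom

end DGOperad

/-! ### Operads given by generators and relations

This gives free operads and pushouts of operads. The relations are given semantically: two formal
expressions in the generators are identified if they take equal values for all admissible values
of the generators in all operads. -/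

namespace DGOperad

variable {k : Type u} [Field k]

/-- Formal operadic expressions in generators `G n a` of arity `n` and degree `a`. -/
inductive Term (k : Type u) (G : ℕ+ → ℤ → Type u) : ℕ+ → ℤ → Type u
  | gen {n a} (x : G n a) : Term k G n a
  | zero {n a} : Term k G n a
  | add {n a} (s t : Term k G n a) : Term k G n a
  | smul {n a} (c : k) (t : Term k G n a) : Term k G n a
  | bd {n a} (b : ℤ) (t : Term k G n a) : Term k G n b
  | ract {n a} (σ : Equiv.Perm (Fin (n : ℕ+))) (t : Term k G n a) : Term k G n a
  | one : Term k G 1 0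
  | comp {r : ℕ+} {i : Fin r → ℕ+} {n : ℕ+} (hn : ∑ j, (i j : ℕ) = n)
      {a : ℤ} {e : Fin r → ℤ} {m : ℤ} (hm : a + ∑ j, e j = m)
      (p : Term k G r a) (q : ∀ j, Term k G (i j) (e j)) : Term k G n m

variable {G : ℕ+ → ℤ → Type u}

/-- The value of an expression in an operad, given the values of the generators. -/
def Term.eval (Q : DGOperad k) (φ : ∀ n a, G n a → Q.El n a) :
    ∀ {n a}, Term k G n a → Q.El n a
  | _, _, .gen x => φ _ _ x
  | _, _, .zero => 0
  | _, _, .add s t => s.eval Q φ + t.eval Q φ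
  | _, _, .smul c t => c • t.eval Q φ
  | _, _, .bd b t => Q.bd _ _ b (t.eval Q φ)
  | _, _, .ract σ t => Q.ract σ _ (t.eval Q φ)
  | _, _, .one => Q.one
  | _, _, .comp hn hm p q => Q.γ hn hm (p.eval Q φ) (fun j => (q j).eval Q φ)

/-- A condition on the values of generators in an operad. -/
abbrev Cond (k : Type u) [Field k] (G : ℕ+ → ℤ → Type u) : Type (u + 1) :=
  ∀ Q : DGOperad k, (∀ n a, G n a → Q.El n a) → Prop

/-- Two expressions are identified if they have the same value for all admissible values of the
generators. -/
def presSetoid (C : Cond k G) (n : ℕ+) (a : ℤ) : Setoid (Term k G n a) where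
  r s t := ∀ Q φ, C Q φ → s.eval Q φ = t.eval Q φ
  iseqv := ⟨fun _ _ _ _ => rfl, fun h Q φ hφ => (h Q φ hφ).symm,
    fun h h' Q φ hφ => (h Q φ hφ).trans (h' Q φ hφ)⟩

/-- The elements of the operad with generators `G` and condition `C`. -/
def Pres (C : Cond k G) (n : ℕ+) (a : ℤ) : Type u := Quotient (presSetoid C n a)

namespace Pres

variable {C : Cond k G}

/-- The class of an expression. -/
def mk (C : Cond k G) {n : ℕ+} {a : ℤ} (t : Term k G n a) : Pres C n a :=
  Quotient.mk (presSetoid C n a) t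

/-- A representative. -/
noncomputable def out {n : ℕ+} {a : ℤ} (x : Pres C n a) : Term k G n a := Quotient.out x

/-- The value of a class. -/
def val {Q : DGOperad k} {φ : ∀ n a, G n a → Q.El n a} (h : C Q φ) {n : ℕ+} {a : ℤ}
    (x : Pres C n a) : Q.El n a :=
  Quotient.lift (fun t => t.eval Q φ) (fun s t (hst : (presSetoid C n a).r s t) => hst Q φ h) x

theorem val_mk {Q : DGOperad k} {φ : ∀ n a, G n a → Q.El n a} (h : C Q φ) {n : ℕ+} {a : ℤ}
    (t : Term k G n a) : val h (mk C t) = t.eval Q φ := rfl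

theorem eval_out {Q : DGOperad k} {φ : ∀ n a, G n a → Q.El n a} (h : C Q φ) {n : ℕ+} {a : ℤ}
    (x : Pres C n a) : (out x).eval Q φ = val h x := by
  rw [← val_mk h]
  exact congrArg (val h) (Quotient.out_eq x)

theorem ext_val {n : ℕ+} {a : ℤ} {x y : Pres C n a}
    (H : ∀ (Q : DGOperad k) (φ : ∀ n a, G n a → Q.El n a) (h : C Q φ), val h x = val h y) :
    x = y := by
  induction x using Quotient.inductionOn with | _ s =>
  induction y using Quotient.inductionOn with | _ t =>
  exact Quotient.sound (fun Q φ h => H Q φ h)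

noncomputable instance (n : ℕ+) (a : ℤ) : Zero (Pres C n a) := ⟨mk C .zero⟩
noncomputable instance (n : ℕ+) (a : ℤ) : Add (Pres C n a) := ⟨fun x y => mk C (.add x.out y.out)⟩
noncomputable instance (n : ℕ+) (a : ℤ) : SMul k (Pres C n a) := ⟨fun c x => mk C (.smul c x.out)⟩
noncomputable instance (n : ℕ+) (a : ℤ) : Neg (Pres C n a) := ⟨fun x => (-1 : k) • x⟩

section

variable {Q : DGOperad k} {φ : ∀ n a, G n a → Q.El n a} (h : C Q φ) {n : ℕ+} {a : ℤ}

theorem val_zero : val h (0 : Pres C n a) = 0 := rfl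
theorem val_add (x y : Pres C n a) : val h (x + y) = val h x + val h y := by
  rw [← eval_out h x, ← eval_out h y]; rfl
theorem val_smul (c : k) (x : Pres C n a) : val h (c • x) = c • val h x := by
  rw [← eval_out h x]; rfl
theorem val_neg (x : Pres C n a) : val h (-x) = - val h x := by
  rw [show -x = (-1 : k) • x from rfl, val_smul, neg_one_smul]

end

noncomputable instance (n : ℕ+) (a : ℤ) : AddCommGroup (Pres C n a) where
  add_assoc x y z := ext_val fun Q φ h => by simp only [val_add, add_assoc]
  zero_add x := ext_val fun Q φ h => by simp only [val_add, val_zero, zero_add]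
  add_zero x := ext_val fun Q φ h => by simp only [val_add, val_zero, add_zero]
  add_comm x y := ext_val fun Q φ h => by simp only [val_add, add_comm]
  neg_add_cancel x := ext_val fun Q φ h => by simp only [val_add, val_neg, val_zero, neg_add_cancel]
  nsmul := nsmulRec
  zsmul := zsmulRec

noncomputable instance (n : ℕ+) (a : ℤ) : Module k (Pres C n a) where
  one_smul x := ext_val fun Q φ h => by simp only [val_smul, one_smul]
  mul_smul c d x := ext_val fun Q φ h => by simp only [val_smul, mul_smul]
  smul_zero c := ext_val fun Q φ h => by simp only [val_smul, val_zero, smul_zero]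
  smul_add c x y := ext_val fun Q φ h => by simp only [val_smul, val_add, smul_add]
  add_smul c d x := ext_val fun Q φ h => by simp only [val_smul, val_add, add_smul]
  zero_smul x := ext_val fun Q φ h => by simp only [val_smul, val_zero, zero_smul]

/-- The value, as a linear map. -/
def valₗ {Q : DGOperad k} {φ : ∀ n a, G n a → Q.El n a} (h : C Q φ) (n : ℕ+) (a : ℤ) :
    Pres C n a →ₗ[k] Q.El n a where
  toFun := val h
  map_add' := val_add h
  map_smul' := val_smul h

/-- The differential. -/
noncomputable def bd (n : ℕ+) (a b : ℤ) : Pres C n a →ₗ[k] Pres C n b where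
  toFun x := mk C (.bd b x.out)
  map_add' x y := ext_val fun Q φ h => by
    simp only [val_mk, Term.eval, eval_out h, val_add, map_add]
  map_smul' c x := ext_val fun Q φ h => by
    simp only [val_mk, Term.eval, eval_out h, val_smul, map_smul, RingHom.id_apply]

/-- The action of permutations. -/
noncomputable def ract (n : ℕ+) (σ : Equiv.Perm (Fin n)) (a : ℤ) :
    Pres C n a →ₗ[k] Pres C n a where
  toFun x := mk C (.ract σ x.out)
  map_add' x y := ext_val fun Q φ h => by
    simp only [val_mk, Term.eval, eval_out h, val_add, map_add]
  map_smul' c x := ext_val fun Q φ h => by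
    simp only [val_mk, Term.eval, eval_out h, val_smul, map_smul, RingHom.id_apply]

theorem val_bd {Q : DGOperad k} {φ : ∀ n a, G n a → Q.El n a} (h : C Q φ) {n : ℕ+} {a b : ℤ}
    (x : Pres C n a) : val h (bd n a b x) = Q.bd n a b (val h x) := by
  rw [← eval_out h x]; rfl

theorem val_ract {Q : DGOperad k} {φ : ∀ n a, G n a → Q.El n a} (h : C Q φ) {n : ℕ+} {a : ℤ}
    (σ : Equiv.Perm (Fin n)) (x : Pres C n a) :
    val h (ract n σ a x) = Q.ract σ a (val h x) := by
  rw [← eval_out h x]; rfl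

/-- The underlying `𝕊`-module. -/
noncomputable def smod (C : Cond k G) : SMod k :=
  SMod.mk' (Pres C) bd
    (fun n a b x hab => ext_val fun Q φ h => by
      rw [val_bd, SMod.bd_eq_zero _ _ _ _ _ hab]; rfl)
    (fun n a b c x => ext_val fun Q φ h => by
      rw [val_bd, val_bd, SMod.bd_bd]; rfl)
    ract
    (fun n σ a b x => ext_val fun Q φ h => by
      rw [val_ract, val_bd, val_bd, val_ract, SMod.ract_bd])
    (fun n a x => ext_val fun Q φ h => by rw [val_ract, SMod.ract_one])
    (fun n σ τ a x => ext_val fun Q φ h => by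
      rw [val_ract, val_ract, val_ract, SMod.ract_mul])

/-- Composition. -/
noncomputable def comp {r : ℕ+} {i : Fin r → ℕ+} {n : ℕ+} (hn : ∑ j, (i j : ℕ) = n)
    {a : ℤ} {e : Fin r → ℤ} {m : ℤ} (hm : a + ∑ j, e j = m)
    (p : Pres C r a) (q : ∀ j, Pres C (i j) (e j)) : Pres C n m :=
  mk C (.comp hn hm p.out fun j => (q j).out)

theorem val_comp {Q : DGOperad k} {φ : ∀ n a, G n a → Q.El n a} (h : C Q φ)
    {r : ℕ+} {i : Fin r → ℕ+} {n : ℕ+} (hn : ∑ j, (i j : ℕ) = n)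
    {a : ℤ} {e : Fin r → ℤ} {m : ℤ} (hm : a + ∑ j, e j = m)
    (p : Pres C r a) (q : ∀ j, Pres C (i j) (e j)) :
    val h (comp hn hm p q) = Q.γ hn hm (val h p) (fun j => val h (q j)) := by
  simp only [comp, val_mk, Term.eval, eval_out h]

theorem val_update {Q : DGOperad k} {φ : ∀ n a, G n a → Q.El n a} (h : C Q φ)
    {r : ℕ+} {i : Fin r → ℕ+} {e : Fin r → ℤ} [DecidableEq (Fin r)]
    (q : ∀ j, Pres C (i j) (e j)) (j : Fin r) (x : Pres C (i j) (e j)) :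
    (fun l => val h (Function.update q j x l)) =
      Function.update (fun l => val h (q l)) j (val h x) := by
  funext l
  by_cases hl : l = j
  · subst hl; simp
  · simp [hl]

/-- Composition, as a multilinear map. -/
noncomputable def γ {r : ℕ+} {i : Fin r → ℕ+} {n : ℕ+} (hn : ∑ j, (i j : ℕ) = n)
    {a : ℤ} {e : Fin r → ℤ} {m : ℤ} (hm : a + ∑ j, e j = m) :
    Pres C r a →ₗ[k] MultilinearMap k (fun j => Pres C (i j) (e j)) (Pres C n m) where
  toFun p :=
    { toFun := comp hn hm p
      map_update_add' := fun q j x y => ext_val fun Q φ h => by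
        simp only [val_add, val_comp, val_update, MultilinearMap.map_update_add]
      map_update_smul' := fun q j c x => ext_val fun Q φ h => by
        simp only [val_smul, val_comp, val_update, MultilinearMap.map_update_smul] }
  map_add' p p' := MultilinearMap.ext fun q => ext_val fun Q φ h => by
    change val h (comp hn hm (p + p') q) = val h (comp hn hm p q + comp hn hm p' q)
    simp only [val_add, val_comp, map_add, add_apply]
  map_smul' c p := MultilinearMap.ext fun q => ext_val fun Q φ h => by
    change val h (comp hn hm (c • p) q) = val h (c • comp hn hm p q)
    simp only [val_smul, val_comp, map_smul, smul_apply]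

theorem val_γ {Q : DGOperad k} {φ : ∀ n a, G n a → Q.El n a} (h : C Q φ)
    {r : ℕ+} {i : Fin r → ℕ+} {n : ℕ+} (hn : ∑ j, (i j : ℕ) = n)
    {a : ℤ} {e : Fin r → ℤ} {m : ℤ} (hm : a + ∑ j, e j = m)
    (p : Pres C r a) (q : ∀ j, Pres C (i j) (e j)) :
    val h (γ hn hm p q) = Q.γ hn hm (val h p) (fun j => val h (q j)) :=
  val_comp h hn hm p q

theorem val_units {Q : DGOperad k} {φ : ∀ n a, G n a → Q.El n a} (h : C Q φ) {n : ℕ+} {a : ℤ}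
    (c : ℤˣ) (x : Pres C n a) : val h (c • x) = c • val h x := by
  rw [Units.smul_def, Units.smul_def]
  exact map_zsmul (valₗ h n a) _ x

theorem val_sum {Q : DGOperad k} {φ : ∀ n a, G n a → Q.El n a} (h : C Q φ) {n : ℕ+} {a : ℤ}
    {ι : Type} (s : Finset ι) (x : ι → Pres C n a) :
    val h (∑ j ∈ s, x j) = ∑ j ∈ s, val h (x j) :=
  map_sum (valₗ h n a) x s

/-- The conditional differential. -/
noncomputable def bdIf {n : ℕ+} (c : Prop) [Decidable c] {a : ℤ} (x : Pres C n a) :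
    Pres C n (if c then a - 1 else a) :=
  (smod C).bdIf (n := n) c x

theorem val_bdIf {Q : DGOperad k} {φ : ∀ n a, G n a → Q.El n a} (h : C Q φ) {n : ℕ+}
    (c : Prop) [Decidable c] {a : ℤ} (x : Pres C n a) :
    val h (bdIf c x) = Q.bdIf c (val h x) :=
  SMod.map_bdIf (M := smod C) (N := Q.toSMod) (fun n a (x : Pres C n a) => val h x)
    (fun _ _ _ x => val_bd h x) c x

theorem bd_γ {r : ℕ+} {i : Fin r → ℕ+} {n : ℕ+} (hn : ∑ j, (i j : ℕ) = n)
    {a : ℤ} {e : Fin r → ℤ} {m : ℤ} (hm : a + ∑ j, e j = m)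
    (p : Pres C r a) (q : ∀ j, Pres C (i j) (e j)) :
    bd n m (m - 1) (γ hn hm p q) = γ hn (deg_left hm) (bd r a (a - 1) p) q +
      ∑ j, (a + ∑ l ∈ Finset.Iio j, e l).negOnePow •
          γ hn (deg_right j hm) p (fun l => bdIf (l = j) (q l)) :=
  ext_val fun Q φ h => by
    rw [val_bd, val_γ, val_add, val_γ, val_bd, val_sum, Q.bd_γ]
    simp only [val_units, val_γ, val_bdIf]

theorem assoc {r : ℕ+} {a : ℤ} (p : Pres C r a)
    {i : Fin r → ℕ+} {e : Fin r → ℤ} (q : ∀ j, Pres C (i j) (e j))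
    {u : ∀ j, Fin (i j) → ℕ+} {f : ∀ j, Fin (i j) → ℤ} (s : ∀ j l, Pres C (u j l) (f j l))
    {n : ℕ+} (hn : ∑ j, (i j : ℕ) = n) {b : ℤ} (hb : a + ∑ j, e j = b)
    {v : Fin r → ℕ+} (hv : ∀ j, ∑ l, (u j l : ℕ) = v j)
    {g : Fin r → ℤ} (hg : ∀ j, e j + ∑ l, f j l = g j)
    {N : ℕ+} (hN : ∑ j, (v j : ℕ) = N)
    (hN' : ∑ x, (u (blocks hn x).1 (blocks hn x).2 : ℕ) = N)
    {m : ℤ} (hm : a + ∑ j, g j = m) (hm' : b + ∑ x, f (blocks hn x).1 (blocks hn x).2 = m) :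
    γ hN' hm' (γ hn hb p q) (fun x => s (blocks hn x).1 (blocks hn x).2) =
      (∑ j, ∑ j' ∈ Finset.Ioi j, e j' * ∑ l, f j l).negOnePow •
        γ hN hm p (fun j => γ (hv j) (hg j) (q j) (s j)) :=
  ext_val fun Q φ h => by
    rw [val_units, val_γ, val_γ, val_γ]
    simp only [val_γ]
    exact Q.assoc (val h p) (fun j => val h (q j)) (fun j l => val h (s j l)) hn hb hv hg hN hN'
      hm hm'

theorem γ_ract {r : ℕ+} {i : Fin r → ℕ+} {n : ℕ+} (hn : ∑ j, (i j : ℕ) = n)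
    {a : ℤ} {e : Fin r → ℤ} {m : ℤ} (hm : a + ∑ j, e j = m)
    (p : Pres C r a) (q : ∀ j, Pres C (i j) (e j)) (σ : Equiv.Perm (Fin r)) :
    γ hn hm (ract r σ a p) q =
      (∑ j, ∑ j' ∈ Finset.Ioi j, if σ j' < σ j then e j * e j' else 0).negOnePow •
        ract n (blockPerm σ hn) m
          (γ (sum_perm σ hn) (deg_perm σ hm) p (fun j => q (σ⁻¹ j))) :=
  ext_val fun Q φ h => by
    rw [val_units, val_ract, val_γ, val_γ, val_ract, Q.γ_ract]

theorem ract_γ {r : ℕ+} {i : Fin r → ℕ+} {n : ℕ+} (hn : ∑ j, (i j : ℕ) = n)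
    {a : ℤ} {e : Fin r → ℤ} {m : ℤ} (hm : a + ∑ j, e j = m)
    (p : Pres C r a) (q : ∀ j, Pres C (i j) (e j)) (τ : ∀ j, Equiv.Perm (Fin (i j))) :
    γ hn hm p (fun j => ract (i j) (τ j) (e j) (q j)) =
      ract n (sumPerm τ hn) m (γ hn hm p q) :=
  ext_val fun Q φ h => by
    rw [val_ract, val_γ, val_γ]
    simp only [val_ract]
    exact Q.ract_γ hn hm _ _ _

/-- The operad with generators `G` and condition `C`. -/
noncomputable def operad (C : Cond k G) : DGOperad k where
  toSMod := smod C
  one := mk C .one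
  bd_one b := ext_val (C := C) fun Q φ h => by
    change val h (bd 1 0 b (mk C .one)) = 0
    rw [val_bd]
    exact Q.bd_one b
  γ {_ _ _} hn {_ _ _} hm := γ (C := C) hn hm
  bd_γ := bd_γ (C := C)
  γ_one p := ext_val (C := C) fun Q φ h => (val_γ (C := C) h _ _ _ _).trans (Q.γ_one _)
  one_γ q := ext_val (C := C) fun Q φ h => (val_γ (C := C) h _ _ _ _).trans (Q.one_γ _)
  assoc := assoc (C := C)
  γ_ract := γ_ract (C := C)
  ract_γ := ract_γ (C := C)

/-- The morphism out of `operad C` given by admissible values of the generators. -/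
noncomputable def desc {Q : DGOperad k} {φ : ∀ n a, G n a → Q.El n a} (h : C Q φ) :
    operad C ⟶ Q where
  hom := SMod.mkHom (M := (operad C).toSMod) (valₗ h) (fun _ _ _ x => val_bd h x)
    (fun _ _ _ x => val_ract h _ x)
  map_one := rfl
  map_γ hn _ _ _ hm p q := val_γ (C := C) h hn hm p q

/-- The generators, as elements. -/
def gen (C : Cond k G) (n : ℕ+) (a : ℤ) (x : G n a) : (operad C).El n a := mk C (.gen x)

theorem desc_gen {Q : DGOperad k} {φ : ∀ n a, G n a → Q.El n a} (h : C Q φ) {n : ℕ+} {a : ℤ}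
    (x : G n a) : SMod.Hom.el (desc h).hom (gen C n a x) = φ n a x := rfl

theorem el_desc {Q : DGOperad k} {φ : ∀ n a, G n a → Q.El n a} (h : C Q φ) {n : ℕ+} {a : ℤ}
    (x : Pres C n a) : SMod.Hom.el (desc h).hom x = val h x := rfl

/-- Equality in `operad C` may be tested on values. -/
theorem el_ext {n : ℕ+} {a : ℤ} {x y : (operad C).El n a}
    (H : ∀ (Q : DGOperad k) (φ : ∀ n a, G n a → Q.El n a) (h : C Q φ),
      SMod.Hom.el (desc h).hom x = SMod.Hom.el (desc h).hom y) : x = y :=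
  ext_val (C := C) H

theorem mk_comp (C : Cond k G) {r : ℕ+} {i : Fin r → ℕ+} {n : ℕ+} (hn : ∑ j, (i j : ℕ) = n)
    {a : ℤ} {e : Fin r → ℤ} {m : ℤ} (hm : a + ∑ j, e j = m)
    (p : Term k G r a) (q : ∀ j, Term k G (i j) (e j)) :
    mk C (.comp hn hm p q) = γ hn hm (mk C p) (fun j => mk C (q j)) :=
  ext_val fun Q φ h => by rw [val_γ]; rfl

/-- Morphisms out of `operad C` are determined by the values of the generators. -/
theorem hom_ext_gen {Q : DGOperad k} {f g : operad C ⟶ Q}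
    (H : ∀ n a x, SMod.Hom.el f.hom (gen C n a x) = SMod.Hom.el g.hom (gen C n a x)) : f = g := by
  have key : ∀ {n a} (t : Term k G n a),
      SMod.Hom.el f.hom (mk C t : (operad C).El n a) =
        SMod.Hom.el g.hom (mk C t : (operad C).El n a) := by
    intro n a t
    induction t with
    | gen x => exact H _ _ x
    | zero => exact (map_zero (SMod.Hom.el f.hom)).trans (map_zero (SMod.Hom.el g.hom)).symm
    | @add n a s t hs ht =>
      have : mk C (.add s t) = mk C s + mk C t := ext_val fun Q φ h => by rw [val_add]; rfl
      rw [this]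
      exact (map_add (SMod.Hom.el f.hom) _ _).trans
        ((congrArg₂ (· + ·) hs ht).trans (map_add (SMod.Hom.el g.hom) _ _).symm)
    | @smul n a c t ht =>
      have : mk C (.smul c t) = c • mk C t := ext_val fun Q φ h => by rw [val_smul]; rfl
      rw [this]
      exact (map_smul (SMod.Hom.el f.hom) c _).trans
        ((congrArg (c • ·) ht).trans (map_smul (SMod.Hom.el g.hom) c _).symm)
    | @bd n a b t ht =>
      have : mk C (.bd b t) = (operad C).bd n a b (mk C t) :=
        ext_val (C := C) fun Q φ h => (val_bd h (mk C t)).symm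
      rw [this]
      exact (SMod.Hom.el_bd f.hom _).trans
        ((congrArg _ ht).trans (SMod.Hom.el_bd g.hom _).symm)
    | @ract n a σ t ht =>
      have : mk C (.ract σ t) = (operad C).ract σ a (mk C t) :=
        ext_val (C := C) fun Q φ h => (val_ract h σ (mk C t)).symm
      rw [this]
      exact (SMod.Hom.el_ract f.hom σ _).trans
        ((congrArg _ ht).trans (SMod.Hom.el_ract g.hom σ _).symm)
    | one => exact f.map_one.trans g.map_one.symm
    | comp hn hm p q hp hq =>
      rw [mk_comp]
      refine (f.map_γ hn hm _ _).trans (Eq.trans ?_ (g.map_γ hn hm _ _).symm)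
      rw [hp]
      simp only [hq]
  refine DGOperad.hom_ext (SMod.hom_ext_el fun n a x => ?_)
  obtain ⟨t, rfl⟩ := Quotient.exists_rep (s := presSetoid C n a) x
  exact key t

end Pres

/-- The condition on `φ : M → Q` to be a morphism of `𝕊`-modules. -/
def freeCond (M : SMod k) : Cond k M.El := fun Q φ =>
  ∃ f : M ⟶ Q.toSMod, ∀ n a x, φ n a x = SMod.Hom.el f x

theorem freeCond_spec {M : SMod k} {Q : DGOperad k} {φ : ∀ n a, M.El n a → Q.El n a}
    (h : freeCond M Q φ) : ∃ f : M ⟶ Q.toSMod, ∀ n a x, φ n a x = SMod.Hom.el f x := h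

/-- The free operad on an `𝕊`-module. -/
noncomputable abbrev freeObj (M : SMod k) : DGOperad k := Pres.operad (freeCond M)

/-- The universal morphism from an `𝕊`-module to its free operad. -/
noncomputable def freeUnit (M : SMod k) : M ⟶ (freeObj M).toSMod :=
  SMod.mkHom
    (fun n a =>
      { toFun := fun x => Pres.gen (freeCond M) n a x
        map_add' := fun x y => Pres.el_ext fun Q φ h => by
          obtain ⟨f, hf⟩ := freeCond_spec h
          rw [map_add, Pres.desc_gen, Pres.desc_gen, Pres.desc_gen, hf, hf, hf, map_add]
        map_smul' := fun c x => Pres.el_ext fun Q φ h => by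
          obtain ⟨f, hf⟩ := freeCond_spec h
          rw [map_smul, Pres.desc_gen, Pres.desc_gen, hf, hf, map_smul, RingHom.id_apply] })
    (fun n a b x => Pres.el_ext fun Q φ h => by
      obtain ⟨f, hf⟩ := freeCond_spec h
      exact (hf _ _ _).trans ((SMod.Hom.el_bd f x).trans
        ((congrArg _ (hf _ _ _).symm).trans (SMod.Hom.el_bd (Pres.desc h).hom (Pres.gen (freeCond M) n a x)).symm)))
    (fun n a σ x => Pres.el_ext fun Q φ h => by
      obtain ⟨f, hf⟩ := freeCond_spec h
      exact (hf _ _ _).trans ((SMod.Hom.el_ract f σ x).trans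
        ((congrArg _ (hf _ _ _).symm).trans (SMod.Hom.el_ract (Pres.desc h).hom σ (Pres.gen (freeCond M) n a x)).symm)))

theorem freeUnit_el (M : SMod k) {n : ℕ+} {a : ℤ} (x : M.El n a) :
    SMod.Hom.el (freeUnit M) x = Pres.gen (freeCond M) n a x := rfl

/-- The universal property of the free operad:
`Hom(F(M), Q) = Hom(M, U(Q))`. -/
noncomputable def freeEquiv (M : SMod k) (Q : DGOperad k) :
    (freeObj M ⟶ Q) ≃ (M ⟶ (forget k).obj Q) where
  toFun g := freeUnit M ≫ g.hom
  invFun f := Pres.desc (C := freeCond M) (φ := fun _ _ x => SMod.Hom.el f x)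
    ⟨f, fun _ _ _ => rfl⟩
  left_inv _ := Pres.hom_ext_gen fun _ _ _ => rfl
  right_inv _ := SMod.hom_ext_el fun _ _ _ => rfl

/-- The free operad functor `F`. -/
noncomputable def free (k : Type u) [Field k] : SMod k ⥤ DGOperad k :=
  Adjunction.leftAdjointOfEquiv (G := forget k) (F_obj := freeObj) freeEquiv
    (fun _ _ _ _ _ => rfl)

/-- The free operad functor is left adjoint to the forgetful functor. -/
noncomputable def freeAdj (k : Type u) [Field k] : free k ⊣ forget k :=
  Adjunction.adjunctionOfEquivLeft (G := forget k) (F_obj := freeObj) freeEquiv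
    (fun _ _ _ _ _ => rfl)

section Pushout

variable {A B D : DGOperad k} (f : D ⟶ A) (g : D ⟶ B)

/-- The condition on `φ : A ⊔ B → Q` to consist of two operad morphisms that agree on `D`. -/
def pushoutCond : Cond k (fun n a => A.El n a ⊕ B.El n a) := fun Q φ =>
  ∃ (s : A ⟶ Q) (t : B ⟶ Q), f ≫ s = g ≫ t ∧
    (∀ n a x, φ n a (.inl x) = SMod.Hom.el s.hom x) ∧
    (∀ n a x, φ n a (.inr x) = SMod.Hom.el t.hom x)

/-- A map into a presented operad that becomes an operad morphism under all admissible values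
is an operad morphism. -/
noncomputable def mkInto {G : ℕ+ → ℤ → Type u} (C : Cond k G) (A : DGOperad k)
    (ι : ∀ n a, A.El n a → (Pres.operad C).El n a)
    (H : ∀ (Q : DGOperad k) (φ : ∀ n a, G n a → Q.El n a) (h : C Q φ),
      ∃ s : A ⟶ Q, ∀ n a x, SMod.Hom.el (Pres.desc h).hom (ι n a x) = SMod.Hom.el s.hom x) :
    A ⟶ Pres.operad C where
  hom := SMod.mkHom
    (fun n a =>
      { toFun := ι n a
        map_add' := fun x y => Pres.el_ext fun Q φ h => by
          obtain ⟨s, hs⟩ := H Q φ h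
          rw [map_add, hs, hs, hs, map_add]
        map_smul' := fun c x => Pres.el_ext fun Q φ h => by
          obtain ⟨s, hs⟩ := H Q φ h
          rw [map_smul, hs, hs, map_smul, RingHom.id_apply] })
    (fun n a b x => Pres.el_ext fun Q φ h => by
      obtain ⟨s, hs⟩ := H Q φ h
      exact (hs _ _ _).trans ((SMod.Hom.el_bd s.hom x).trans
        ((congrArg _ (hs _ _ _).symm).trans (SMod.Hom.el_bd (Pres.desc h).hom _).symm)))
    (fun n a σ x => Pres.el_ext fun Q φ h => by
      obtain ⟨s, hs⟩ := H Q φ h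
      exact (hs _ _ _).trans ((SMod.Hom.el_ract s.hom σ x).trans
        ((congrArg _ (hs _ _ _).symm).trans (SMod.Hom.el_ract (Pres.desc h).hom σ _).symm)))
  map_one := Pres.el_ext fun Q φ h => by
    obtain ⟨s, hs⟩ := H Q φ h
    exact (hs _ _ _).trans (s.map_one.trans (Pres.desc h).map_one.symm)
  map_γ hn _ _ _ hm p q := Pres.el_ext fun Q φ h => by
    obtain ⟨s, hs⟩ := H Q φ h
    refine (hs _ _ _).trans ((s.map_γ hn hm p q).trans
      (Eq.trans ?_ ((Pres.desc h).map_γ hn hm _ _).symm))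
    rw [← hs]
    simp only [← hs]
    rfl

/-- The first coprojection. -/
noncomputable def pinl : A ⟶ Pres.operad (pushoutCond f g) :=
  mkInto _ A (fun n a x => Pres.gen (pushoutCond f g) n a (.inl x))
    fun _ _ ⟨s, _, _, hs, _⟩ => ⟨s, hs⟩

/-- The second coprojection. -/
noncomputable def pinr : B ⟶ Pres.operad (pushoutCond f g) :=
  mkInto _ B (fun n a x => Pres.gen (pushoutCond f g) n a (.inr x))
    fun _ _ ⟨_, t, _, _, ht⟩ => ⟨t, ht⟩

theorem pushout_w : f ≫ pinl f g = g ≫ pinr f g :=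
  DGOperad.hom_ext <| SMod.hom_ext_el fun n a x => Pres.el_ext fun _ _ ⟨_, _, hst, hs, ht⟩ =>
    (hs n a (SMod.Hom.el f.hom x)).trans
      ((congrArg (fun z => SMod.Hom.el (DGOperad.Hom.hom z) x) hst).trans
        (ht n a (SMod.Hom.el g.hom x)).symm)

/-- The values of the generators given by two operad morphisms. -/
def pval {Q : DGOperad k} (s : A ⟶ Q) (t : B ⟶ Q) (n : ℕ+) (a : ℤ) :
    A.El n a ⊕ B.El n a → Q.El n a
  | .inl x => SMod.Hom.el s.hom x
  | .inr x => SMod.Hom.el t.hom x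

theorem pval_cond {Q : DGOperad k} (s : A ⟶ Q) (t : B ⟶ Q) (w : f ≫ s = g ≫ t) :
    pushoutCond f g Q (pval s t) :=
  ⟨s, t, w, fun _ _ _ => rfl, fun _ _ _ => rfl⟩

theorem isPushout : IsPushout f g (pinl f g) (pinr f g) where
  w := pushout_w f g
  isColimit' := ⟨PushoutCocone.IsColimit.mk _
    (fun c => Pres.desc (pval_cond f g c.inl c.inr c.condition))
    (fun c => DGOperad.hom_ext <| SMod.hom_ext_el fun n a x => rfl)
    (fun c => DGOperad.hom_ext <| SMod.hom_ext_el fun n a x => rfl)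
    (fun c m h₁ h₂ => Pres.hom_ext_gen fun n a x => by
      cases x with
      | inl x => exact congrArg (fun z => SMod.Hom.el (DGOperad.Hom.hom z) x) h₁
      | inr x => exact congrArg (fun z => SMod.Hom.el (DGOperad.Hom.hom z) x) h₂)⟩

end Pushout

/-- The category of operads has pushouts. -/
instance : HasPushouts (DGOperad k) :=
  have {X Y Z : DGOperad k} {f : X ⟶ Y} {g : X ⟶ Z} : HasColimit (span f g) :=
    (isPushout f g).hasPushout
  hasPushouts_of_hasColimit_span _

end DGOperad

/-! ### Truncation -/

namespace SMod

variable {k : Type u} [Field k]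

/-- The elements of arity `> n`: everything in arities `> n`, zero in arities `≤ n`. -/
def above (M : SMod k) (n : ℕ) (j : ℕ+) (a : ℤ) : Submodule k (M.El j a) :=
  if (j : ℕ) ≤ n then ⊥ else ⊤

theorem mem_above {M : SMod k} {n : ℕ} {j : ℕ+} {a : ℤ} {x : M.El j a} :
    x ∈ M.above n j a ↔ ((j : ℕ) ≤ n → x = 0) := by
  unfold above
  split_ifs with h <;> simp [h]

theorem above_le_comap {M N : SMod k} {n : ℕ} {j : ℕ+} {a b : ℤ} (f : M.El j a →ₗ[k] N.El j b) :
    M.above n j a ≤ (N.above n j b).comap f := fun x hx =>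
  mem_above.2 fun h => by rw [mem_above.1 hx h, map_zero]

/-- The `𝕊`-module `θ_n(M)`: the components of arity `≤ n` are those of `M` (as the quotient by
`0`), those of arity `> n` are zero. -/
def truncObj (n : ℕ) (M : SMod k) : SMod k :=
  mk' (fun j a => M.El j a ⧸ M.above n j a)
    (fun j a b => Submodule.mapQ _ _ (M.bd j a b) (above_le_comap _))
    (fun j a b x h => by
      induction x using Submodule.Quotient.induction_on with | _ x =>
      rw [Submodule.mapQ_apply, bd_eq_zero _ _ _ _ _ h, Submodule.Quotient.mk_zero])
    (fun j a b c x => by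
      induction x using Submodule.Quotient.induction_on with | _ x =>
      rw [Submodule.mapQ_apply, Submodule.mapQ_apply, bd_bd, Submodule.Quotient.mk_zero])
    (fun j σ a => Submodule.mapQ _ _ (M.ract σ a) (above_le_comap _))
    (fun j σ a b x => by
      induction x using Submodule.Quotient.induction_on with | _ x =>
      simp only [Submodule.mapQ_apply]
      rw [ract_bd])
    (fun j a x => by
      induction x using Submodule.Quotient.induction_on with | _ x =>
      rw [Submodule.mapQ_apply, ract_one])
    (fun j σ τ a x => by
      induction x using Submodule.Quotient.induction_on with | _ x =>
      simp only [Submodule.mapQ_apply]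
      rw [ract_mul])

/-- The class of an element in the truncation. -/
def toTrunc (n : ℕ) (M : SMod k) {j : ℕ+} {a : ℤ} (x : M.El j a) : (truncObj n M).El j a :=
  (Submodule.Quotient.mk x : M.El j a ⧸ M.above n j a)

theorem toTrunc_surj (n : ℕ) (M : SMod k) {j : ℕ+} {a : ℤ} (y : (truncObj n M).El j a) :
    ∃ x : M.El j a, toTrunc n M x = y :=
  Submodule.Quotient.mk_surjective (M.above n j a) y

theorem toTrunc_eq {n : ℕ} {M : SMod k} {j : ℕ+} {a : ℤ} {x y : M.El j a} :
    toTrunc n M x = toTrunc n M y ↔ ((j : ℕ) ≤ n → x = y) := by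
  refine (Submodule.Quotient.eq (M.above n j a)).trans ?_
  rw [mem_above]
  simp only [sub_eq_zero]

/-- The functor `θ_n` on `𝕊`-modules. -/
def trunc (k : Type u) [Field k] (n : ℕ) : SMod k ⥤ SMod k where
  obj := truncObj n
  map {M N} f := mkHom (M := truncObj n M) (N := truncObj n N)
    (fun j a => Submodule.mapQ (M.above n j a) (N.above n j a) (Hom.el f) (above_le_comap _))
    (fun j a b x => by
      obtain ⟨x, rfl⟩ := toTrunc_surj n M x
      exact congrArg (toTrunc n N) (Hom.el_bd f x))
    (fun j a σ x => by
      obtain ⟨x, rfl⟩ := toTrunc_surj n M x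
      exact congrArg (toTrunc n N) (Hom.el_ract f σ x))
  map_id M := hom_ext_el fun j a x => by
    obtain ⟨x, rfl⟩ := toTrunc_surj n M x
    rfl
  map_comp {M N P} f g := hom_ext_el fun j a x => by
    obtain ⟨x, rfl⟩ := toTrunc_surj n M x
    rfl

/-- An `n`-isomorphism of `𝕊`-modules: a morphism that is an isomorphism in arities `≤ n`. -/
def IsNIso (n : ℕ) {M N : SMod k} (f : M ⟶ N) : Prop := IsIso ((trunc k n).map f)

end SMod

namespace DGOperad

variable {k : Type u} [Field k]

theorem arity_le {r : ℕ} {i : Fin r → ℕ+} {n : ℕ+} (hn : ∑ j, (i j : ℕ) = n) :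
    r ≤ n ∧ ∀ j, (i j : ℕ) ≤ n := by
  constructor
  · calc r = ∑ _j : Fin r, 1 := by simp
      _ ≤ ∑ j, (i j : ℕ) := Finset.sum_le_sum fun j _ => (i j).pos
      _ = n := hn
  · intro j
    rw [← hn]
    exact Finset.single_le_sum (f := fun j => (i j : ℕ)) (fun _ _ => Nat.zero_le _)
      (Finset.mem_univ j)

/-- A representative of an element of the truncation. -/
noncomputable def lift {n : ℕ} {P : SMod k} {j : ℕ+} {a : ℤ} (x : (P.truncObj n).El j a) :
    P.El j a := (P.toTrunc_surj n x).choose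

theorem toTrunc_lift {n : ℕ} {P : SMod k} {j : ℕ+} {a : ℤ} (x : (P.truncObj n).El j a) :
    P.toTrunc n (lift x) = x := (P.toTrunc_surj n x).choose_spec

theorem lift_toTrunc {n : ℕ} {P : SMod k} {j : ℕ+} {a : ℤ} (x : P.El j a) (h : (j : ℕ) ≤ n) :
    lift (P.toTrunc n x) = x := SMod.toTrunc_eq.1 (toTrunc_lift _) h

theorem trunc_ext {n : ℕ} {P : SMod k} {j : ℕ+} {a : ℤ} {x y : (P.truncObj n).El j a}
    (h : (j : ℕ) ≤ n → lift x = lift y) : x = y := by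
  rw [← toTrunc_lift x, ← toTrunc_lift y]
  exact SMod.toTrunc_eq.2 h

section

variable {n : ℕ} {P : SMod k} {j : ℕ+} {a : ℤ}

theorem lift_zero (h : (j : ℕ) ≤ n) : lift (0 : (P.truncObj n).El j a) = 0 := lift_toTrunc 0 h
theorem lift_add (h : (j : ℕ) ≤ n) (x y : (P.truncObj n).El j a) : lift (x + y) = lift x + lift y := by
  conv_lhs => rw [← toTrunc_lift x, ← toTrunc_lift y]
  exact lift_toTrunc (lift x + lift y) h
theorem lift_smul (h : (j : ℕ) ≤ n) (c : k) (x : (P.truncObj n).El j a) : lift (c • x) = c • lift x := by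
  conv_lhs => rw [← toTrunc_lift x]
  exact lift_toTrunc (c • lift x) h

/-- In arities `≤ n` the truncation does not change anything. -/
noncomputable def liftₗ (h : (j : ℕ) ≤ n) (a : ℤ) : (P.truncObj n).El j a →ₗ[k] P.El j a where
  toFun := lift
  map_add' := lift_add h
  map_smul' := lift_smul h

theorem lift_units (h : (j : ℕ) ≤ n) (c : ℤˣ) (x : (P.truncObj n).El j a) : lift (c • x) = c • lift x := by
  rw [Units.smul_def, Units.smul_def]
  exact map_zsmul (liftₗ h a) _ x
theorem lift_sum (h : (j : ℕ) ≤ n) {ι : Type} (s : Finset ι) (x : ι → (P.truncObj n).El j a) :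
    lift (∑ l ∈ s, x l) = ∑ l ∈ s, lift (x l) :=
  map_sum (liftₗ h a) x s
theorem lift_bd (h : (j : ℕ) ≤ n) {b : ℤ} (x : (P.truncObj n).El j a) :
    lift ((P.truncObj n).bd j a b x) = P.bd j a b (lift x) := by
  conv_lhs => rw [← toTrunc_lift x]
  exact lift_toTrunc (P.bd j a b (lift x)) h
theorem lift_ract (h : (j : ℕ) ≤ n) (σ : Equiv.Perm (Fin j)) (x : (P.truncObj n).El j a) :
    lift ((P.truncObj n).ract σ a x) = P.ract σ a (lift x) := by
  conv_lhs => rw [← toTrunc_lift x]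
  exact lift_toTrunc (P.ract σ a (lift x)) h
theorem lift_bdIf (h : (j : ℕ) ≤ n) (c : Prop) [hc : Decidable c] (x : (P.truncObj n).El j a) :
    lift ((P.truncObj n).bdIf c x) = P.bdIf c (lift x) := by
  cases hc with
  | isTrue _ => exact lift_bd h x
  | isFalse _ => rfl

end

section

variable (n : ℕ) (P : DGOperad k)

/-- Composition in the truncated operad: compose representatives. The result does not depend on
the representatives, and it is zero in arities `> n`. -/
noncomputable def tcomp {r : ℕ+} {i : Fin r → ℕ+} {N : ℕ+} (hN : ∑ j, (i j : ℕ) = N)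
    {a : ℤ} {e : Fin r → ℤ} {m : ℤ} (hm : a + ∑ j, e j = m)
    (p : (P.truncObj n).El r a) (q : ∀ j, (P.truncObj n).El (i j) (e j)) :
    (P.truncObj n).El N m :=
  P.toTrunc n (P.γ hN hm (lift p) (fun j => lift (q j)))

variable {n P}

theorem lift_tcomp {r : ℕ+} {i : Fin r → ℕ+} {N : ℕ+} (hN : ∑ j, (i j : ℕ) = N)
    {a : ℤ} {e : Fin r → ℤ} {m : ℤ} (hm : a + ∑ j, e j = m) (h : (N : ℕ) ≤ n)
    (p : (P.truncObj n).El r a) (q : ∀ j, (P.truncObj n).El (i j) (e j)) :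
    lift (tcomp n P hN hm p q) = P.γ hN hm (lift p) (fun j => lift (q j)) :=
  lift_toTrunc _ h

theorem lift_update {r : ℕ+} {i : Fin r → ℕ+} {e : Fin r → ℤ} [DecidableEq (Fin r)]
    (q : ∀ j, (P.truncObj n).El (i j) (e j)) (j : Fin r) (x : (P.truncObj n).El (i j) (e j)) :
    (fun l => lift (Function.update q j x l)) =
      Function.update (fun l => lift (q l)) j (lift x) := by
  funext l
  by_cases hl : l = j
  · subst hl; simp
  · simp [hl]

variable (n P)

/-- Composition in the truncated operad, as a multilinear map. -/
noncomputable def tγ {r : ℕ+} {i : Fin r → ℕ+} {N : ℕ+} (hN : ∑ j, (i j : ℕ) = N)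
    {a : ℤ} {e : Fin r → ℤ} {m : ℤ} (hm : a + ∑ j, e j = m) :
    (P.truncObj n).El r a →ₗ[k]
      MultilinearMap k (fun j => (P.truncObj n).El (i j) (e j)) ((P.truncObj n).El N m) where
  toFun p :=
    { toFun := tcomp n P hN hm p
      map_update_add' := fun q j x y => trunc_ext fun h => by
        simp only [lift_add h, lift_tcomp hN hm h, lift_update,
          lift_add (((arity_le hN).2 j).trans h), MultilinearMap.map_update_add]
      map_update_smul' := fun q j c x => trunc_ext fun h => by
        simp only [lift_smul h, lift_tcomp hN hm h, lift_update,
          lift_smul (((arity_le hN).2 j).trans h), MultilinearMap.map_update_smul] }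
  map_add' p p' := MultilinearMap.ext fun q => trunc_ext fun h => by
    change lift (tcomp n P hN hm (p + p') q) = lift (tcomp n P hN hm p q + tcomp n P hN hm p' q)
    simp only [lift_add h, lift_tcomp hN hm h, lift_add ((arity_le hN).1.trans h), map_add,
      add_apply]
  map_smul' c p := MultilinearMap.ext fun q => trunc_ext fun h => by
    change lift (tcomp n P hN hm (c • p) q) = lift (c • tcomp n P hN hm p q)
    simp only [lift_smul h, lift_tcomp hN hm h, lift_smul ((arity_le hN).1.trans h), map_smul,
      smul_apply]

variable {n P}

theorem lift_tγ {r : ℕ+} {i : Fin r → ℕ+} {N : ℕ+} (hN : ∑ j, (i j : ℕ) = N)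
    {a : ℤ} {e : Fin r → ℤ} {m : ℤ} (hm : a + ∑ j, e j = m) (h : (N : ℕ) ≤ n)
    (p : (P.truncObj n).El r a) (q : ∀ j, (P.truncObj n).El (i j) (e j)) :
    lift (tγ n P hN hm p q) = P.γ hN hm (lift p) (fun j => lift (q j)) :=
  lift_tcomp hN hm h p q

end

/-- The quotient of an operad by the operadic ideal of the elements of arity `> n`. -/
noncomputable def truncObj (n : ℕ) (P : DGOperad k) : DGOperad k where
  toSMod := P.toSMod.truncObj n
  one := P.toTrunc n P.one
  bd_one b := trunc_ext fun h => by
    rw [lift_bd h, lift_toTrunc _ h, P.bd_one, lift_zero h]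
  γ := tγ n P
  bd_γ {r i N} hN {a e m} hm p q := trunc_ext fun h => by
    have hr := (arity_le hN).1.trans h
    have hi := fun j => ((arity_le hN).2 j).trans h
    rw [lift_bd h, lift_tγ hN hm h, P.bd_γ, lift_add h, lift_sum h, lift_tγ hN _ h, lift_bd hr]
    simp only [lift_units h, lift_tγ hN _ h, lift_bdIf (hi _)]
  γ_one {r a} p := trunc_ext fun h => by
    have h1 : ((1 : ℕ+) : ℕ) ≤ n := le_trans r.pos h
    rw [lift_tγ _ _ h]
    simp only [lift_toTrunc P.one h1]
    exact P.γ_one _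
  one_γ {N m} q := trunc_ext fun h => by
    have h1 : ((1 : ℕ+) : ℕ) ≤ n := le_trans N.pos h
    refine (lift_tγ _ _ h _ _).trans ?_
    rw [lift_toTrunc P.one h1]
    exact P.one_γ _
  assoc {r a} p {i e} q {u f} s {N} hN {b} hb {v} hv {g} hg {K} hK hK' {m} hm hm' :=
    trunc_ext fun h => by
      have h1 := (arity_le hK').1.trans h
      have h2 := fun j => ((arity_le hK).2 j).trans h
      rw [lift_units h, lift_tγ hK' _ h, lift_tγ hK _ h, lift_tγ hN hb h1]
      simp only [lift_tγ (hv _) _ (h2 _)]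
      exact P.assoc (lift p) (fun j => lift (q j)) (fun j l => lift (s j l)) hN hb hv hg hK hK'
        hm hm'
  γ_ract {r i N} hN {a e m} hm p q σ := trunc_ext fun h => by
    have hr := (arity_le hN).1.trans h
    rw [lift_units h, lift_ract h, lift_tγ hN _ h, lift_tγ _ _ h, lift_ract hr, P.γ_ract]
  ract_γ {r i N} hN {a e m} hm p q τ := trunc_ext fun h => by
    have hi := fun j => ((arity_le hN).2 j).trans h
    rw [lift_ract h, lift_tγ hN _ h, lift_tγ hN _ h]
    simp only [lift_ract (hi _)]
    exact P.ract_γ hN hm _ _ _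

/-- The operads that are zero in arities `> n`. -/
def IsNullAbove (k : Type u) [Field k] (n : ℕ) : ObjectProperty (DGOperad k) := fun P =>
  ∀ (j : ℕ+) (a : ℤ), n < j → ∀ x : P.El j a, x = 0

/-- The category of `n`-operads. -/
abbrev NOperad (k : Type u) [Field k] (n : ℕ) := (IsNullAbove k n).FullSubcategory

theorem lift_map {n : ℕ} {M N : SMod k} (f : M ⟶ N) {j : ℕ+} {a : ℤ} (h : (j : ℕ) ≤ n)
    (x : (M.truncObj n).El j a) :
    lift (SMod.Hom.el ((SMod.trunc k n).map f) x) = SMod.Hom.el f (lift x) := by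
  conv_lhs => rw [← toTrunc_lift x]
  exact lift_toTrunc (SMod.Hom.el f (lift x)) h

theorem truncMap_γ {n : ℕ} {P Q : DGOperad k} (f : P ⟶ Q)
    {r : ℕ+} {i : Fin r → ℕ+} {N : ℕ+} (hN : ∑ j, (i j : ℕ) = N)
    {a : ℤ} {e : Fin r → ℤ} {m : ℤ} (hm : a + ∑ j, e j = m)
    (p : (P.toSMod.truncObj n).El r a) (q : ∀ j, (P.toSMod.truncObj n).El (i j) (e j)) :
    SMod.Hom.el ((SMod.trunc k n).map f.hom) (tγ n P hN hm p q) =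
      tγ n Q hN hm (SMod.Hom.el ((SMod.trunc k n).map f.hom) p)
        (fun j => SMod.Hom.el ((SMod.trunc k n).map f.hom) (q j)) :=
  trunc_ext fun h => by
    have hr := (arity_le hN).1.trans h
    have hi := fun j => ((arity_le hN).2 j).trans h
    refine (lift_map f.hom h _).trans ((congrArg _ (lift_tγ hN hm h p q)).trans
      ((f.map_γ hN hm _ _).trans (Eq.trans ?_ (lift_tγ hN hm h _ _).symm)))
    have hp := lift_map f.hom hr p
    have hq : (fun j => lift (SMod.Hom.el ((SMod.trunc k n).map f.hom) (q j))) =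
        fun j => SMod.Hom.el f.hom (lift (q j)) := funext fun j => lift_map f.hom (hi j) (q j)
    exact ((congrArg₂ (fun x y => Q.γ hN hm x y) hp hq)).symm

/-- The truncation functor `T_n` from operads to `n`-operads. -/
noncomputable def trunc (k : Type u) [Field k] (n : ℕ) : DGOperad k ⥤ NOperad k n where
  obj P := ⟨P.truncObj n, fun _ _ hj _ => trunc_ext fun h => absurd h (not_le.2 hj)⟩
  map {_ Q} f := ObjectProperty.homMk
    { hom := (SMod.trunc k n).map f.hom
      map_one := congrArg (Q.toTrunc n) f.map_one
      map_γ := truncMap_γ f }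
  map_id P := ObjectProperty.hom_ext _ <| DGOperad.hom_ext ((SMod.trunc k n).map_id P.toSMod)
  map_comp f g := ObjectProperty.hom_ext _ <| DGOperad.hom_ext <|
    (SMod.trunc k n).map_comp f.hom g.hom

/-- An `n`-isomorphism of operads: a morphism whose truncation is an isomorphism of
`n`-operads. -/
def IsNIso (n : ℕ) {P Q : DGOperad k} (f : P ⟶ Q) : Prop := IsIso ((trunc k n).map f)

end DGOperad

/-! ### Polynomial operads -/

section Polynomial

variable {𝒪 𝒮 : Type*} [Category 𝒪] [Category 𝒮] {F : 𝒮 ⥤ 𝒪} {U : 𝒪 ⥤ 𝒮} [HasPushouts 𝒪]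

/-- For a functor `U` (from operads to `𝕊`-modules) with left adjoint `F`, an operad `E` and a
morphism `i : U(E) ⟶ M` of `𝕊`-modules, the polynomial operad `E[M]`, that is the pushout of
`F(M) ⟵ F(U(E)) ⟶ E`, where the left arrow is `F(i)` and the right arrow is the counit. -/
noncomputable abbrev polyOperad (adj : F ⊣ U) {E : 𝒪} {M : 𝒮} (i : U.obj E ⟶ M) : 𝒪 :=
  pushout (F.map i) (adj.counit.app E)

/-- The canonical morphism `α : E ⟶ E[M]`. -/
noncomputable abbrev polyα (adj : F ⊣ U) {E : 𝒪} {M : 𝒮} (i : U.obj E ⟶ M) :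
    E ⟶ polyOperad adj i :=
  pushout.inr (F.map i) (adj.counit.app E)

end Polynomial

/-! ### Differential graded modules with augmentation and coaugmentation

The base field, concentrated in degree `0`, is the unit of the tensor product. The sequence that
has it in every arity is the operad `Com`. A sequence of augmentations and coaugmentations of the
components of an operad `P` such that the structure morphisms of `P` are compatible
with the (tensor products of the) augmentations and coaugmentations is the same as a pair of operad
morphisms `ε : P ⟶ Com` and `η : Com ⟶ P` with `ε ∘ η = id`; similarly for `𝕊`-modules. -/

/-- An object with an augmentation and a coaugmentation over `X`. -/
structure Augmented {C : Type*} [Category C] (X : C) where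
  obj : C
  ε : obj ⟶ X
  η : X ⟶ obj
  η_ε : η ≫ ε = 𝟙 X

namespace Augmented

variable {C : Type*} [Category C] {X : C}

/-- Morphisms that preserve augmentation and coaugmentation. -/
@[ext]
structure Hom (A B : Augmented X) where
  hom : A.obj ⟶ B.obj
  hom_ε : hom ≫ B.ε = A.ε
  η_hom : A.η ≫ hom = B.η

instance : Category (Augmented X) where
  Hom := Hom
  id A := ⟨𝟙 _, by simp, by simp⟩
  comp f g := ⟨f.hom ≫ g.hom, by rw [Category.assoc, g.hom_ε, f.hom_ε],
    by rw [← Category.assoc, f.η_hom, g.η_hom]⟩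

@[ext]
theorem hom_ext {A B : Augmented X} {f g : A ⟶ B} (h : f.hom = g.hom) : f = g := Hom.ext h

@[simp] theorem id_hom (A : Augmented X) : Hom.hom (𝟙 A) = 𝟙 _ := rfl
@[simp] theorem comp_hom {A B D : Augmented X} (f : A ⟶ B) (g : B ⟶ D) :
    (f ≫ g).hom = f.hom ≫ g.hom := rfl

theorem hom_w {A B D : Augmented X} {f : A ⟶ B} {g : B ⟶ D} {h : A ⟶ D} (w : f ≫ g = h) :
    f.hom ≫ g.hom = h.hom := by rw [← w, comp_hom]

section Pushout

variable [HasPushouts C] {A B D : Augmented X} (f : D ⟶ A) (g : D ⟶ B)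

/-- The pushout, computed in `C`. -/
noncomputable def push : Augmented X where
  obj := pushout f.hom g.hom
  ε := pushout.desc A.ε B.ε (by rw [f.hom_ε, g.hom_ε])
  η := A.η ≫ pushout.inl _ _
  η_ε := by rw [Category.assoc, pushout.inl_desc, A.η_ε]

/-- The first coprojection. -/
noncomputable def pinl : A ⟶ push f g where
  hom := pushout.inl _ _
  hom_ε := pushout.inl_desc _ _ _
  η_hom := rfl

/-- The second coprojection. -/
noncomputable def pinr : B ⟶ push f g where
  hom := pushout.inr _ _
  hom_ε := pushout.inr_desc _ _ _
  η_hom := by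
    change B.η ≫ pushout.inr _ _ = A.η ≫ pushout.inl _ _
    rw [← f.η_hom, ← g.η_hom, Category.assoc, Category.assoc, pushout.condition]

/-- The morphism out of the pushout. -/
noncomputable def pdesc {Q : Augmented X} (s : A ⟶ Q) (t : B ⟶ Q) (w : f ≫ s = g ≫ t) :
    push f g ⟶ Q where
  hom := pushout.desc s.hom t.hom (congrArg Hom.hom w)
  hom_ε := by
    change pushout.desc s.hom t.hom _ ≫ Q.ε = pushout.desc A.ε B.ε _
    apply pushout.hom_ext
    · rw [pushout.inl_desc_assoc, s.hom_ε, pushout.inl_desc]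
    · rw [pushout.inr_desc_assoc, t.hom_ε, pushout.inr_desc]
  η_hom := by
    change (A.η ≫ pushout.inl _ _) ≫ pushout.desc s.hom t.hom _ = _
    rw [Category.assoc, pushout.inl_desc, s.η_hom]

theorem isPushout : IsPushout f g (pinl f g) (pinr f g) where
  w := hom_ext pushout.condition
  isColimit' := ⟨PushoutCocone.IsColimit.mk _
    (fun c => pdesc f g c.inl c.inr c.condition)
    (fun _ => hom_ext (pushout.inl_desc _ _ _))
    (fun _ => hom_ext (pushout.inr_desc _ _ _))
    (fun _ _ h₁ h₂ => hom_ext (pushout.hom_ext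
      ((congrArg Hom.hom h₁).trans (pushout.inl_desc _ _ _).symm)
      ((congrArg Hom.hom h₂).trans (pushout.inr_desc _ _ _).symm)))⟩

instance : HasPushouts (Augmented X) :=
  have {A B D : Augmented X} {f : D ⟶ A} {g : D ⟶ B} : HasColimit (span f g) :=
    (isPushout f g).hasPushout
  hasPushouts_of_hasColimit_span _

end Pushout

section Functor

variable {D : Type*} [Category D] {F : D ⥤ C} {U : C ⥤ D}

/-- The functor induced by `U`. -/
@[simps]
def map (U : C ⥤ D) (X : C) : Augmented X ⥤ Augmented (U.obj X) where
  obj A := ⟨U.obj A.obj, U.map A.ε, U.map A.η, by rw [← U.map_comp, A.η_ε, U.map_id]⟩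
  map f := ⟨U.map f.hom, by simp only [← U.map_comp, f.hom_ε],
    by simp only [← U.map_comp, f.η_hom]⟩

variable [HasPushouts C] (adj : F ⊣ U)

/-- The left adjoint of the induced functor, on objects: the pushout of
`F(M) ⟵ F(U(X)) ⟶ X`. -/
noncomputable def freeObj (M : Augmented (U.obj X)) : Augmented X where
  obj := pushout (F.map M.η) (adj.counit.app X)
  ε := pushout.desc (F.map M.ε ≫ adj.counit.app X) (𝟙 X) (by
    rw [← Category.assoc, ← F.map_comp, M.η_ε]
    simp)
  η := pushout.inr _ _
  η_ε := pushout.inr_desc _ _ _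

/-- The universal property: from left to right. -/
noncomputable def toMap (M : Augmented (U.obj X)) (B : Augmented X)
    (g : pushout (F.map M.η) (adj.counit.app X) ⟶ B.obj)
    (hε : g ≫ B.ε = pushout.desc (F.map M.ε ≫ adj.counit.app X) (𝟙 X) (by
      rw [← Category.assoc, ← F.map_comp, M.η_ε]
      simp))
    (hη : pushout.inr _ _ ≫ g = B.η) : M ⟶ (map U X).obj B where
  hom := adj.homEquiv _ _ (pushout.inl _ _ ≫ g)
  hom_ε := by
    change _ ≫ U.map B.ε = _
    rw [← Adjunction.homEquiv_naturality_right, Category.assoc, hε, pushout.inl_desc]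
    simp [Adjunction.homEquiv_unit]
  η_hom := by
    change M.η ≫ (show M.obj ⟶ U.obj B.obj from adj.homEquiv _ _ (pushout.inl _ _ ≫ g)) = U.map B.η
    rw [← Adjunction.homEquiv_naturality_left, ← Category.assoc, pushout.condition,
      Category.assoc, hη]
    simp [Adjunction.homEquiv_unit]

/-- The universal property: from right to left. -/
noncomputable def ofMap (M : Augmented (U.obj X)) (B : Augmented X) (f : M.obj ⟶ U.obj B.obj)
    (hε : f ≫ U.map B.ε = M.ε) (hη : M.η ≫ f = U.map B.η) : freeObj adj M ⟶ B where
  hom := pushout.desc ((adj.homEquiv _ _).symm f) B.η (by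
    rw [← Adjunction.homEquiv_naturality_left_symm, hη]
    simp [Adjunction.homEquiv_counit])
  hom_ε := by
    change pushout.desc _ _ _ ≫ B.ε = pushout.desc _ _ _
    apply pushout.hom_ext
    · rw [pushout.inl_desc_assoc, pushout.inl_desc, ← Adjunction.homEquiv_naturality_right_symm, hε]
      simp [Adjunction.homEquiv_counit]
    · rw [pushout.inr_desc_assoc, pushout.inr_desc, B.η_ε]
  η_hom := pushout.inr_desc _ _ _

/-- The universal property. -/
noncomputable def freeEquiv (M : Augmented (U.obj X)) (B : Augmented X) :
    (freeObj adj M ⟶ B) ≃ (M ⟶ (map U X).obj B) where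
  toFun g := toMap adj M B g.hom g.hom_ε g.η_hom
  invFun f := ofMap adj M B f.hom f.hom_ε f.η_hom
  left_inv g := hom_ext (pushout.hom_ext
    ((pushout.inl_desc _ _ _).trans ((adj.homEquiv _ _).symm_apply_apply _))
    ((pushout.inr_desc _ _ _).trans g.η_hom.symm))
  right_inv _ := hom_ext
    ((congrArg (adj.homEquiv _ _) (pushout.inl_desc _ _ _)).trans
      ((adj.homEquiv _ _).apply_symm_apply _))

theorem freeEquiv_naturality (M : Augmented (U.obj X)) (B B' : Augmented X) (g : B ⟶ B')
    (h : freeObj adj M ⟶ B) :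
    freeEquiv adj M B' (h ≫ g) = freeEquiv adj M B h ≫ (map U X).map g :=
  hom_ext ((congrArg (adj.homEquiv _ _) (Category.assoc (pushout.inl _ _) h.hom g.hom).symm).trans
    (adj.homEquiv_naturality_right _ _))

/-- The left adjoint of the induced functor. -/
noncomputable def free : Augmented (U.obj X) ⥤ Augmented X :=
  Adjunction.leftAdjointOfEquiv (G := map U X) (freeEquiv adj)
    (freeEquiv_naturality adj)

/-- The adjunction. -/
noncomputable def freeAdj : free (X := X) adj ⊣ map U X :=
  Adjunction.adjunctionOfEquivLeft (G := map U X) (freeEquiv adj)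
    (freeEquiv_naturality adj)

end Functor

end Augmented

namespace DGOperad

section Com

variable (k : Type u) [Field k]

/-- The base field concentrated in degree `0`. -/
def unitDeg (a : ℤ) : Submodule k k where
  carrier := {x | a ≠ 0 → x = 0}
  add_mem' hx hy h := by rw [hx h, hy h, add_zero]
  zero_mem' _ := rfl
  smul_mem' c x hx h := by rw [hx h, smul_zero]

variable {k} in
theorem coe_units_smul {a : ℤ} (c : ℤˣ) (x : unitDeg k a) : ((c • x : unitDeg k a) : k) = c • x := by
  rw [Units.smul_def, Units.smul_def]
  exact Submodule.coe_smul_of_tower _ _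

/-- The `𝕊`-module with `k` in every arity. -/
def comSMod : SMod k :=
  SMod.mk' (fun _ a => unitDeg k a) (fun _ _ _ => 0) (fun _ _ _ _ _ => rfl)
    (fun _ _ _ _ _ => rfl) (fun _ _ _ => LinearMap.id) (fun _ _ _ _ _ => rfl)
    (fun _ _ _ => rfl) (fun _ _ _ _ _ => rfl)

/-- The scalar given by an element of `comSMod`. -/
def sc {n : ℕ+} {a : ℤ} (x : (comSMod k).El n a) : k := Subtype.val (p := (· ∈ unitDeg k a)) x

variable {k}

theorem sc_ext {n : ℕ+} {a : ℤ} {x y : (comSMod k).El n a} (h : sc k x = sc k y) : x = y :=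
  Subtype.ext h

theorem sc_eq_zero {n : ℕ+} {a : ℤ} (x : (comSMod k).El n a) (h : a ≠ 0) : sc k x = 0 :=
  x.2 h

theorem mul_mem {r : ℕ} {a : ℤ} {e : Fin r → ℤ} {m : ℤ} (hm : a + ∑ j, e j = m)
    (p : unitDeg k a) (q : ∀ j, unitDeg k (e j)) : (p : k) * ∏ j, (q j : k) ∈ unitDeg k m := by
  intro h
  by_cases ha : a = 0
  · have : ∃ j, e j ≠ 0 := by
      by_contra! hc
      apply h
      rw [← hm, ha]
      simp [hc]
    obtain ⟨j, hj⟩ := this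
    rw [Finset.prod_eq_zero (Finset.mem_univ j) ((q j).2 hj), mul_zero]
  · rw [p.2 ha, zero_mul]

/-- Multiplication of scalars. -/
def comγ {r : ℕ+} {i : Fin r → ℕ+} {n : ℕ+} {a : ℤ} {e : Fin r → ℤ} {m : ℤ}
    (hm : a + ∑ j, e j = m) :
    (comSMod k).El r a →ₗ[k]
      MultilinearMap k (fun j => (comSMod k).El (i j) (e j)) ((comSMod k).El n m) where
  toFun p :=
    { toFun := fun q => (⟨_, mul_mem (k := k) hm p q⟩ : unitDeg k m)
      map_update_add' := fun q j x y => sc_ext <| by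
        have := (MultilinearMap.mkPiAlgebra k (Fin r) k).compLinearMap
          (fun j => (unitDeg k (e j)).subtype) |>.map_update_add q j x y
        exact (congrArg (fun x => sc k p * x) this).trans (mul_add _ _ _)
      map_update_smul' := fun q j c x => sc_ext <| by
        have := (MultilinearMap.mkPiAlgebra k (Fin r) k).compLinearMap
          (fun j => (unitDeg k (e j)).subtype) |>.map_update_smul q j c x
        exact (congrArg (fun x => sc k p * x) this).trans (mul_left_comm _ _ _) }
  map_add' p p' := MultilinearMap.ext fun q => sc_ext <| add_mul _ _ _
  map_smul' c p := MultilinearMap.ext fun q => sc_ext <| mul_assoc _ _ _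

theorem sc_γ {r : ℕ+} {i : Fin r → ℕ+} {n : ℕ+} {a : ℤ} {e : Fin r → ℤ} {m : ℤ}
    (hm : a + ∑ j, e j = m) (p : (comSMod k).El r a) (q : ∀ j, (comSMod k).El (i j) (e j)) :
    sc k (comγ (n := n) hm p q) = sc k p * ∏ j, sc k (q j) := rfl

theorem sc_units {n : ℕ+} {a : ℤ} (c : ℤˣ) (x : (comSMod k).El n a) :
    sc k (c • x) = c • sc k x := coe_units_smul (k := k) c x

theorem sc_bdIf {n : ℕ+} {a : ℤ} (c : Prop) [hc : Decidable c] (h : c) (x : (comSMod k).El n a) :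
    sc k ((comSMod k).bdIf c x) = 0 := by
  cases hc with
  | isTrue _ => rfl
  | isFalse h' => exact absurd h h'

theorem prod_units {m : ℤ} {x : k} (h : m ≠ 0 → x = 0) : m.negOnePow • x = x := by
  by_cases hm : m = 0
  · rw [hm, Int.negOnePow_zero, one_smul]
  · rw [h hm, smul_zero]

variable (k) in
/-- The operad `Com`: the base field in every arity, with the trivial actions and with
multiplication of scalars as composition. -/
def com : DGOperad k where
  toSMod := comSMod k
  one := (⟨1, fun h => absurd rfl h⟩ : unitDeg k 0)
  bd_one _ := rfl
  γ {_ _ _} _ {_ _ _} hm := comγ hm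
  bd_γ {r i n} hn {a e m} hm p q := by
    have h1 : ∀ j, comγ (k := k) (n := n) (deg_right j hm) p
        (fun l => (comSMod k).bdIf (l = j) (q l)) = 0 := fun j => sc_ext <| by
      rw [sc_γ, Finset.prod_eq_zero (Finset.mem_univ j) (sc_bdIf _ rfl _), mul_zero]
      rfl
    have h2 : (comSMod k).bd r a (a - 1) p = 0 := rfl
    simp only [h1, h2, smul_zero, Finset.sum_const_zero, map_zero, add_zero]
    rfl
  γ_one p := sc_ext <|
    (sc_γ _ p _).trans <| (congrArg (sc k p * ·) Finset.prod_const_one).trans (mul_one _)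
  one_γ q := sc_ext <|
    (sc_γ _ _ (fun _ => q)).trans <| (one_mul _).trans
      (Fintype.prod_unique (fun _ : Fin 1 => sc k q))
  assoc {r a} p {i e} q {u f} s {n} hn {b} hb {v} hv {g} hg {N} hN hN' {m} hm hm' := sc_ext <| by
    have key : ∏ x, sc k (s (blocks hn x).1 (blocks hn x).2) = ∏ j, ∏ l, sc k (s j l) := by
      rw [Equiv.prod_comp (blocks hn) (fun y : Σ j, Fin (i j) => sc k (s y.1 y.2))]
      exact Fintype.prod_sigma _
    rw [sc_units, prod_units]
    · simp only [sc_γ, key, Finset.prod_mul_distrib, mul_assoc]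
    · intro h
      have : ∃ j, e j ≠ 0 := by
        by_contra! hc
        simp [hc] at h
      obtain ⟨j, hj⟩ := this
      rw [sc_γ, Finset.prod_eq_zero (Finset.mem_univ j), mul_zero]
      rw [sc_γ, sc_eq_zero _ hj, zero_mul]
  γ_ract {r i n} hn {a e m} hm p q σ := sc_ext <| by
    have key : ∏ j, sc k (q (σ⁻¹ j)) = ∏ j, sc k (q j) :=
      Equiv.prod_comp σ⁻¹ fun j => sc k (q j)
    rw [sc_units, prod_units]
    · exact congrArg (sc k p * ·) key.symm
    · intro h
      have : ∃ j, e j ≠ 0 := by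
        by_contra! hc
        simp [hc] at h
      obtain ⟨j, hj⟩ := this
      change sc k p * ∏ j, sc k (q (σ⁻¹ j)) = 0
      rw [key, Finset.prod_eq_zero (Finset.mem_univ j) (sc_eq_zero _ hj), mul_zero]
  ract_γ {_ _ _} _ {_ _ _} _ _ _ _ := rfl

end Com

end DGOperad

/-- `𝕊`-modules in differential graded modules with augmentation and coaugmentation. -/
abbrev SModDGA (k : Type u) [Field k] := Augmented ((DGOperad.forget k).obj (DGOperad.com k))

/-- Operads in differential graded modules with augmentation and coaugmentation. -/
abbrev DGAOperad (k : Type u) [Field k] := Augmented (DGOperad.com k)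

/-- The forgetful functor from operads to `𝕊`-modules, with augmentations and coaugmentations. -/
abbrev DGAOperad.forget (k : Type u) [Field k] : DGAOperad k ⥤ SModDGA k :=
  Augmented.map (DGOperad.forget k) (DGOperad.com k)

/-- The free operad functor, with augmentations and coaugmentations. -/
noncomputable abbrev DGAOperad.free (k : Type u) [Field k] : SModDGA k ⥤ DGAOperad k :=
  Augmented.free (DGOperad.freeAdj k)

/-- The free operad functor is left adjoint to the forgetful functor. -/
noncomputable abbrev DGAOperad.freeAdj (k : Type u) [Field k] :
    DGAOperad.free k ⊣ DGAOperad.forget k :=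
  Augmented.freeAdj (DGOperad.freeAdj k)

/-! Being an `n`-isomorphism is a property that can be tested by mapping out. Call a morphism `f : A
⟶ B` local if, for every object `Z` that vanishes in arities `> n`, each morphism `A ⟶ Z` extends
uniquely along `f`. Truncation is the reflection onto the full subcategory of such `Z`, both for
`𝕊`-modules and for operads, so by Yoneda and two-out-of-three the local morphisms are exactly the
`n`-isomorphisms (the two lemmas `isNIso_iff_isLocal`).

Local morphisms behave well under the constructions that give `E[M]`. They are stable under cobase
change (`isLocal_of_isPushout`), and a left adjoint `F` sends local morphisms to local morphisms as
soon as `U` sends test objects to test objects (`isLocal_map_of_adjunction`); here an operad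
vanishes in arities `> n` exactly when its underlying `𝕊`-module does. Hence `F(i)` is local, and so
is `α`, which is a cobase change of `F(i)`. No explicit description of free operads or of their
pushouts is needed.

With augmentations and coaugmentations the test objects remain plain operads, and locality is asked
of underlying morphisms only. Pushouts of augmented objects are pushouts of the underlying objects,
and the underlying morphism of the augmented `F(i)` is a cobase change of the plain `F(i)`
(`isPushout_free_map`). Thus the underlying `α` arises from the plain `F(i)` by two cobase changes,
and is local again.

Arities start at `1`, so no factor of a composite has larger arity than the composite. This is what
makes the elements of arity `> n` an ideal and the projection to the truncation a morphism of
operads. -/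

/-! ### Local morphisms: cobase change, left adjoints, reflections -/

namespace CategoryTheory.ObjectProperty

variable {C : Type*} [Category C] (P : ObjectProperty C)

/-- A morphism from the pushout to `Z` is a compatible pair of morphisms from `B` and `D`. If `f` is
local, the component on `B` exists and is determined by the component on `D`: it is the unique
extension along `f` of the restriction to `A`. -/
theorem isLocal_of_isPushout {A B D E : C} {f : A ⟶ B} {g : A ⟶ D} {inl : B ⟶ E} {inr : D ⟶ E}
    (sq : IsPushout f g inl inr) (hf : P.isLocal f) : P.isLocal inr := fun Z hZ => by
  refine ⟨fun s t hst => ?_, fun s => ?_⟩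
  · refine sq.hom_ext ((hf Z hZ).1 ?_) hst
    change f ≫ inl ≫ s = f ≫ inl ≫ t
    rw [sq.w_assoc, sq.w_assoc]
    exact congrArg (g ≫ ·) hst
  · obtain ⟨t, ht⟩ := (hf Z hZ).2 (g ≫ s)
    exact ⟨sq.desc t s ht, sq.inr_desc t s ht⟩

/-- Under the bijections `Hom(F(-), Z) = Hom(-, U(Z))`, precomposition with `F(i)` becomes
precomposition with `i`, which is bijective because `U(Z)` is a test object for `i`. -/
theorem isLocal_map_of_adjunction {D : Type*} [Category D] {F : D ⥤ C} {U : C ⥤ D} (adj : F ⊣ U)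
    {Q : ObjectProperty D} (hU : ∀ Z, P Z → Q (U.obj Z)) {M N : D} {i : M ⟶ N}
    (hi : Q.isLocal i) : P.isLocal (F.map i) := fun Z hZ => by
  have : (fun g : F.obj N ⟶ Z => F.map i ≫ g) =
      (adj.homEquiv M Z).symm ∘ (fun g => i ≫ g) ∘ adj.homEquiv N Z := by
    funext g
    simp [Adjunction.homEquiv_naturality_left_symm]
  rw [this]
  exact (adj.homEquiv M Z).symm.bijective.comp ((hi _ (hU Z hZ)).comp (adj.homEquiv N Z).bijective)

/-- If `P` is reflective with reflections `u`, then the `P`-local morphisms are those that become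
isomorphisms under reflection. -/
theorem isLocal_iff_of_reflection {A B A' B' : C} {f : A ⟶ B} {f' : A' ⟶ B'} {u : A ⟶ A'}
    {v : B ⟶ B'} (w : u ≫ f' = f ≫ v) (hA : P A') (hB : P B') (hu : P.isLocal u)
    (hv : P.isLocal v) : P.isLocal f ↔ IsIso f' := by
  -- Between objects of `P`, local means invertible (Yoneda). As `u` and `v` are local,
  -- two-out-of-three passes from `f'` to the common diagonal of the square, and from there to `f`.
  rw [← P.isLocal_iff_isIso f' hA hB, ← P.isLocal.precomp_iff u f' hu, w,
    P.isLocal.postcomp_iff f v hv]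

end CategoryTheory.ObjectProperty

/-! ### Truncation of `𝕊`-modules as a reflection -/

namespace SMod

variable {k : Type u} [Field k]

/-- The `𝕊`-modules that are zero in arities `> n`. -/
def IsNullAbove (k : Type u) [Field k] (n : ℕ) : ObjectProperty (SMod k) := fun M =>
  ∀ (j : ℕ+) (a : ℤ), n < j → ∀ x : M.El j a, x = 0

theorem truncObj_isNullAbove (n : ℕ) (M : SMod k) : IsNullAbove k n (M.truncObj n) :=
  fun _ _ hj x => by
    obtain ⟨x, rfl⟩ := toTrunc_surj n M x
    exact toTrunc_eq.2 fun h => absurd h (not_le.2 hj)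

/-- The projection to the truncation. -/
def toTruncHom (n : ℕ) (M : SMod k) : M ⟶ M.truncObj n :=
  mkHom (fun j a => (M.above n j a).mkQ) (fun _ _ _ _ => rfl) (fun _ _ _ _ => rfl)

theorem toTruncHom_naturality (n : ℕ) {M N : SMod k} (f : M ⟶ N) :
    toTruncHom n M ≫ (trunc k n).map f = f ≫ toTruncHom n N := rfl

/-- The morphism out of the truncation given by a morphism to an `𝕊`-module that is zero in
arities `> n`. -/
def truncDesc {n : ℕ} {M N : SMod k} (hN : IsNullAbove k n N) (f : M ⟶ N) : M.truncObj n ⟶ N :=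
  mkHom (M := M.truncObj n)
    (fun j a => (M.above n j a).liftQ (Hom.el f) fun x hx => by
      -- In arities `≤ n` the submodule divided out is zero; in arities `> n` it is everything, but
      -- there the target is zero.
      by_cases h : (j : ℕ) ≤ n
      · rw [mem_above.1 hx h]
        exact zero_mem _
      · exact hN j a (not_le.1 h) _)
    (fun _ _ _ x => by
      obtain ⟨x, rfl⟩ := toTrunc_surj n M x
      exact Hom.el_bd f x)
    (fun _ _ _ x => by
      obtain ⟨x, rfl⟩ := toTrunc_surj n M x
      exact Hom.el_ract f _ x)

theorem truncHom_ext {n : ℕ} {M N : SMod k} {f g : M.truncObj n ⟶ N}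
    (h : toTruncHom n M ≫ f = toTruncHom n M ≫ g) : f = g :=
  hom_ext_el fun j a x => by
    obtain ⟨x, rfl⟩ := toTrunc_surj n M x
    exact congrArg (fun h => Hom.el h x) h

/-- This is the universal property of the truncation as a reflection: `truncDesc` gives the
factorization, and surjectivity of the projection gives its uniqueness. -/
theorem isLocal_toTruncHom (n : ℕ) (M : SMod k) : (IsNullAbove k n).isLocal (toTruncHom n M) :=
  fun _ hN => ⟨fun _ _ h => truncHom_ext h, fun f => ⟨truncDesc hN f, rfl⟩⟩

/-- Replaces the definition through `θ_n` by a mapping-out condition, which is compatible with left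
adjoints and pushouts. -/
theorem isNIso_iff_isLocal {n : ℕ} {M N : SMod k} (f : M ⟶ N) :
    IsNIso n f ↔ (IsNullAbove k n).isLocal f :=
  ((IsNullAbove k n).isLocal_iff_of_reflection (toTruncHom_naturality n f)
    (truncObj_isNullAbove n M) (truncObj_isNullAbove n N) (isLocal_toTruncHom n M)
    (isLocal_toTruncHom n N)).symm

end SMod

/-! ### Truncation of operads as a reflection -/

namespace DGOperad

variable {k : Type u} [Field k]

/-- The projection to the truncation. -/
noncomputable def toTruncHom (n : ℕ) (P : DGOperad k) : P ⟶ P.truncObj n where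
  hom := P.toSMod.toTruncHom n
  map_one := rfl
  map_γ hN _ _ _ hm p q := trunc_ext fun h => by
    -- Only composites of arity `N ≤ n` have to be compared. Since all arities are at least `1`, the
    -- factors then have arity `≤ n` too, where the representatives chosen to define the composition
    -- are the given elements themselves.
    have hr := (arity_le hN).1.trans h
    have hi := fun j => ((arity_le hN).2 j).trans h
    refine (lift_toTrunc _ h).trans (Eq.trans ?_ (lift_tγ hN hm h _ _).symm)
    exact congrArg₂ (fun x y => P.γ hN hm x y) (lift_toTrunc p hr).symm
      (funext fun j => (lift_toTrunc (q j) (hi j)).symm)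

theorem toTruncHom_naturality (n : ℕ) {P Q : DGOperad k} (f : P ⟶ Q) :
    toTruncHom n P ≫ ((trunc k n).map f).hom = f ≫ toTruncHom n Q := rfl

/-- The morphism out of the truncation given by a morphism to an operad that is zero in
arities `> n`. -/
noncomputable def truncDesc {n : ℕ} {P Q : DGOperad k} (hQ : IsNullAbove k n Q) (f : P ⟶ Q) :
    P.truncObj n ⟶ Q where
  hom := SMod.truncDesc (M := P.toSMod) (N := Q.toSMod) hQ f.hom
  map_one := f.map_one
  map_γ {r i N} hN {a e m} hm p q := by
    -- The descended morphism may be computed on the representative chosen by `lift`, in every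
    -- arity: above `n` the choice is arbitrary, but `f` does not see it.
    have key : ∀ {j : ℕ+} {a : ℤ} (x : (P.toSMod.truncObj n).El j a),
        SMod.Hom.el f.hom (lift x) =
          SMod.Hom.el (SMod.truncDesc (M := P.toSMod) (N := Q.toSMod) hQ f.hom) x := fun x => by
      conv_rhs => rw [← toTrunc_lift x]
      rfl
    -- A composite in the truncation is by definition the class of the composite of representatives,
    -- so the left side is the value of `f` at that composite.
    refine (f.map_γ hN hm (lift p) fun j => lift (q j)).trans ?_
    exact congrArg₂ (fun x y => Q.γ hN hm x y) (key p) (funext fun j => key (q j))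

/-- The same universal property for operads. Uniqueness is inherited from `𝕊`-modules, because a
morphism of operads is determined by its underlying morphism. -/
theorem isLocal_toTruncHom (n : ℕ) (P : DGOperad k) :
    (IsNullAbove k n).isLocal (toTruncHom n P) := fun _ hQ =>
  ⟨fun _ _ h => hom_ext (SMod.truncHom_ext (congrArg Hom.hom h)), fun f => ⟨truncDesc hQ f, rfl⟩⟩

theorem isNIso_iff_isLocal {n : ℕ} {P Q : DGOperad k} (f : P ⟶ Q) :
    IsNIso n f ↔ (IsNullAbove k n).isLocal f :=
  -- `T_n` takes values in the full subcategory of `n`-operads; invertibility there is the same as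
  -- invertibility in all operads, where the reflection criterion applies.
  (isIso_iff_of_reflects_iso ((trunc k n).map f) (IsNullAbove k n).ι).symm.trans
    ((IsNullAbove k n).isLocal_iff_of_reflection (toTruncHom_naturality n f)
      ((trunc k n).obj P).property ((trunc k n).obj Q).property (isLocal_toTruncHom n P)
      (isLocal_toTruncHom n Q)).symm

end DGOperad

/-! ### Locality of `α : E ⟶ E[M]` -/

section Polynomial

variable {C D : Type*} [Category C] [Category D] [HasPushouts C] {F : D ⥤ C} {U : C ⥤ D}
  (adj : F ⊣ U) {P : ObjectProperty C} {Q : ObjectProperty D}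

/-- `α` lies opposite `F(i)` in the defining pushout square, and `F(i)` is local by the adjunction.
-/
theorem isLocal_polyα (hU : ∀ Z, P Z → Q (U.obj Z)) {E : C} {M : D} {i : U.obj E ⟶ M}
    (hi : Q.isLocal i) : P.isLocal (polyα adj i) :=
  P.isLocal_of_isPushout (IsPushout.of_hasPushout _ _) (P.isLocal_map_of_adjunction adj hU hi)

/-! ### Augmented objects: reduction to underlying morphisms -/

namespace Augmented

variable {X : C}

/-- The pushout of augmented objects is isomorphic to `push f g`, whose underlying square is a
pushout in `C`. So the underlying coprojection is, up to an isomorphism, a cobase change of `f.hom`.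
-/
theorem isLocal_inr_hom {A B E : Augmented X} (f : E ⟶ A) (g : E ⟶ B) (hf : P.isLocal f.hom) :
    P.isLocal (pushout.inr f g).hom := by
  let e := (isPushout f g).isoPushout
  have h₁ : (pinr f g).hom ≫ e.hom.hom = (pushout.inr f g).hom :=
    hom_w (isPushout f g).inr_isoPushout_hom
  have h₂ : P.isLocal (pinr f g).hom :=
    P.isLocal_of_isPushout (IsPushout.of_hasPushout f.hom g.hom) hf
  have : IsIso e.hom.hom :=
    ⟨e.inv.hom, hom_w e.hom_inv_id, hom_w e.inv_hom_id⟩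
  rw [← h₁]
  exact P.isLocal.comp_mem _ _ h₂ (P.isLocal_of_isIso _)

theorem inl_free_map {M N : Augmented (U.obj X)} (i : M ⟶ N) :
    pushout.inl (F.map M.η) (adj.counit.app X) ≫ ((free adj).map i).hom =
      F.map i.hom ≫ pushout.inl (F.map N.η) (adj.counit.app X) := by
  refine (pushout.inl_desc _ _ _).trans ?_
  -- By construction `(free adj).map i` corresponds under the universal property to `i` followed by
  -- the unit at `N`; its component on `F(M)` is the transpose of that composite under `adj`.
  change (adj.homEquiv _ _).symm (i.hom ≫ adj.homEquiv _ _ (pushout.inl _ _ ≫ 𝟙 _)) = _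
  rw [Adjunction.homEquiv_naturality_left_symm, Equiv.symm_apply_apply, Category.comp_id]

/-- The free augmented object on `M` is `F(M)` with `F(U(X))` collapsed to `X`. Collapsing along
`M.η` and then pushing out along `F(i)` is the same as collapsing `F(N)` along `N.η = M.η ≫ i`. This
links the augmented free functor to `F`, so that locality of `F(i)` passes to it. -/
theorem isPushout_free_map {M N : Augmented (U.obj X)} (i : M ⟶ N) :
    IsPushout (F.map i.hom) (pushout.inl (F.map M.η) (adj.counit.app X))
      (pushout.inl (F.map N.η) (adj.counit.app X)) ((free adj).map i).hom := by
  -- About the induced morphism, only its restrictions to `F(M)` and to `X` are needed.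
  have key : ∀ φ : pushout (F.map M.η) (adj.counit.app X) ⟶ pushout (F.map N.η) (adj.counit.app X),
      pushout.inl _ _ ≫ φ = F.map i.hom ≫ pushout.inl _ _ → pushout.inr _ _ ≫ φ = pushout.inr _ _ →
      IsPushout (F.map i.hom) (pushout.inl _ _) (pushout.inl _ _) φ := fun φ hl hr => by
    -- Pasting: the left square is the pushout defining the free object on `M`, and the outer
    -- rectangle is the one defining the free object on `N`, since `F(M.η) ≫ F(i) = F(N.η)`. Hence
    -- the right square is a pushout.
    refine IsPushout.of_left (h₁₁ := F.map M.η) (v₁₁ := adj.counit.app X) ?_ hl.symm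
      (IsPushout.of_hasPushout _ _)
    rw [hr, ← F.map_comp, i.η_hom]
    exact IsPushout.of_hasPushout _ _
  exact key _ (inl_free_map adj i) ((free adj).map i).η_hom

/-- Two cobase changes in `C`: from `F(i)` to the underlying morphism of the augmented free map, and
from there to the underlying morphism of `α`. -/
theorem isLocal_polyα_hom (hU : ∀ Z, P Z → Q (U.obj Z)) {E : Augmented X}
    {M : Augmented (U.obj X)} {i : (map U X).obj E ⟶ M} (hi : Q.isLocal i.hom) :
    P.isLocal (polyα (freeAdj adj) i).hom :=
  isLocal_inr_hom _ _ <|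
    P.isLocal_of_isPushout (isPushout_free_map adj i) (P.isLocal_map_of_adjunction adj hU hi)

end Augmented

end Polynomial

theorem mainTheorem4 (k : Type u) [Field k] (n : ℕ) :
    (∀ (E : DGOperad k) (M : SMod k) (i : (DGOperad.forget k).obj E ⟶ M),
      SMod.IsNIso n i → DGOperad.IsNIso n (polyα (DGOperad.freeAdj k) i)) ∧
    (∀ (E : DGAOperad k) (M : SModDGA k) (i : (DGAOperad.forget k).obj E ⟶ M),
      SMod.IsNIso n i.hom → DGOperad.IsNIso n (polyα (DGAOperad.freeAdj k) i).hom) := by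
  -- `U` does not change elements, so the two vanishing conditions coincide.
  have hU : ∀ Z, DGOperad.IsNullAbove k n Z → SMod.IsNullAbove k n ((DGOperad.forget k).obj Z) :=
    fun _ hZ => hZ
  exact ⟨fun E M i hi => (DGOperad.isNIso_iff_isLocal _).2
      (isLocal_polyα _ hU ((SMod.isNIso_iff_isLocal i).1 hi)),
    fun E M i hi => (DGOperad.isNIso_iff_isLocal _).2
      (Augmented.isLocal_polyα_hom _ hU ((SMod.isNIso_iff_isLocal i.hom).1 hi))⟩
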